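/- Let $\mathfrak{o}$ be a complete discrete valuation ring of characteristic $0$ with finite residue field $\mathbb{F}_q$ of characteristic $2$, maximal ideal $\wp$ and uniformizer $\pi$. Define $e$ by $2\mathfrak{o}=\wp^{e}$, let $\ell>e$, and write $\mathfrak{o}_k=\mathfrak{o}/\wp^k$. For $i\le 2\ell$ let $K^{i}=\ker(\mathrm{SL}_2(\mathfrak{o}_{2\ell})\to\mathrm{SL}_2(\mathfrak{o}_{i}))$. Fix an additive character $\psi:\mathfrak{o}_{2\ell}\to\mathbb{C}^\times$ with $\psi(\pi^{2\ell-1})\neq 1$. For $A\in M_2(\mathfrak{o}_\ell)$ let $\psi_{[A]}$ be the one-dimensional character of $K^{\ell}$ given by $\psi_{[A]}(I+\pi^{\ell}B)=\psi(\pi^{\ell}\,\mathrm{tr}(\hat{A}B))$, where $\hat{A}\in M_2(\mathfrak{o}_{2\ell})$ is any lift of $A$, and let $\mathrm{Irr}(\mathrm{SL}_2(\mathfrak{o}_{2\ell})\mid\psi_{[A]})$ be the set of irreducible complex constituents of $\mathrm{Ind}_{K^{\ell}}^{\mathrm{SL}_2(\mathfrak{o}_{2\ell})}\psi_{[A]}$.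 Call $A$ cyclic if $\{v,Av\}$ generates $\mathfrak{o}_\ell^{2}$ for some $v\in\mathfrak{o}_\ell^{2}$, and let $\bar{A}\in M_2(\mathbb{F}_q)$ be its reduction modulo $\wp$; $\bar{A}$ is split semisimple if it is semisimple with all eigenvalues in $\mathbb{F}_q$. An irreducible complex representation of $\mathrm{SL}_2(\mathfrak{o}_{2\ell})$ is primitive if neither it nor any of its twists by one-dimensional characters is trivial on $K^{2\ell-1}$. Then the following hold. 0. Every primitive irreducible representation of $\mathrm{SL}_2(\mathfrak{o}_{2\ell})$ has dimension at most $(q+1)q^{2\ell-1}$. 1. For every cyclic $A\in M_2(\mathfrak{o}_\ell)$ and every $\rho\in\mathrm{Irr}(\mathrm{SL}_2(\mathfrak{o}_{2\ell})\mid\psi_{[A]})$, one has $\dim\rho=(q+1)q^{2\ell-1}$ if and only if $\bar{A}$ is split semisimple. 2. The group $\mathrm{SL}_2(\mathfrak{o}_{2\ell})$ has exactly $\frac{(q-1)^2q^{2\ell-2}}{2}$ inequivalent primitive irreducible representations of dimension $(q+1)q^{2\ell-1}$. -/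

import Mathlib

open scoped Matrix

noncomputable section

namespace SLTwo

open IsLocalRing

section Rings

variable (O : Type*) [CommRing O] [IsLocalRing O]

/-- The finite quotient `𝔬_k = 𝔬 / ℘ ^ k`. -/
abbrev Quo (k : ℕ) : Type _ := O ⧸ maximalIdeal O ^ k

/-- The natural surjection `𝔬_r → 𝔬_i` for `i ≤ r`. -/
abbrev red {i r : ℕ} (h : i ≤ r) : Quo O r →+* Quo O i :=
  Ideal.Quotient.factorPow (maximalIdeal O) h

/-- The natural surjection `𝔬_k → 𝔬 / ℘` onto the residue field, for `k ≥ 1`. -/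
def toResidue {k : ℕ} (h : 1 ≤ k) : Quo O k →+* ResidueField O :=
  Ideal.Quotient.factor (Ideal.pow_le_self (Nat.one_le_iff_ne_zero.mp h))

/-- The number `q` of elements of the residue field. -/
def residueCard : ℕ := Nat.card (ResidueField O)

/-- The group `SL₂(𝔬_r)`. -/
abbrev SL (r : ℕ) : Type _ := Matrix.SpecialLinearGroup (Fin 2) (Quo O r)

/-- The congruence subgroup `K^i`, the kernel of `SL₂(𝔬_r) → SL₂(𝔬_i)`. -/
def congruenceSubgroup {i r : ℕ} (h : i ≤ r) : Subgroup (SL O r) :=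
  (Matrix.SpecialLinearGroup.map (n := Fin 2) (red O h)).ker

end Rings

section Matrices

/-- `A` is cyclic: some `v` is such that `v, A v, …, A ^ (n - 1) v` generate `R ^ n`. -/
def IsCyclicMatrix {R : Type*} [CommRing R] {n : ℕ} (A : Matrix (Fin n) (Fin n) R) : Prop :=
  ∃ v : Fin n → R,
    Submodule.span R (Set.range fun j : Fin n => (A ^ (j : ℕ)) *ᵥ v) = ⊤

/-- A matrix over a field is split semisimple: it is semisimple and all its eigenvalues lie in
the field. -/
def IsSplitSemisimple {k : Type*} [Field k] {n : ℕ} (A : Matrix (Fin n) (Fin n) k) : Prop :=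
  A.charpoly.Splits ∧ Module.End.IsSemisimple (Matrix.toLin' A)

end Matrices

section Characters

variable {O : Type*} [CommRing O] [IsLocalRing O] {l : ℕ}

/-- An entrywise lift `Â ∈ M₂(𝔬_{2ℓ})` of `A ∈ M₂(𝔬_ℓ)`. -/
def lift (A : Matrix (Fin 2) (Fin 2) (Quo O l)) : Matrix (Fin 2) (Fin 2) (Quo O (2 * l)) :=
  A.map (Function.surjInv
    (Ideal.Quotient.factor_surjective
      (Ideal.pow_le_pow_right (I := maximalIdeal O) (by omega : l ≤ 2 * l))))

theorem lift_map (A : Matrix (Fin 2) (Fin 2) (Quo O l)) :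
    (lift A).map (red O (by omega : l ≤ 2 * l)) = A := by
  ext i j
  exact Function.surjInv_eq (Ideal.Quotient.factor_surjective
      (Ideal.pow_le_pow_right (I := maximalIdeal O) (by omega : l ≤ 2 * l))) (A i j)

theorem mul_eq_zero_of_red {x y : Quo O (2 * l)}
    (hx : red O (by omega : l ≤ 2 * l) x = 0) (hy : red O (by omega : l ≤ 2 * l) y = 0) :
    x * y = 0 := by
  obtain ⟨a, rfl⟩ := Ideal.Quotient.mk_surjective x
  obtain ⟨b, rfl⟩ := Ideal.Quotient.mk_surjective y
  have ha : a ∈ maximalIdeal O ^ l := Ideal.Quotient.eq_zero_iff_mem.mp hx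
  have hb : b ∈ maximalIdeal O ^ l := Ideal.Quotient.eq_zero_iff_mem.mp hy
  rw [← map_mul, Ideal.Quotient.eq_zero_iff_mem, two_mul, pow_add]
  exact Ideal.mul_mem_mul ha hb

theorem red_sub_one (k : congruenceSubgroup O (by omega : l ≤ 2 * l)) (i j : Fin 2) :
    red O (by omega : l ≤ 2 * l)
      ((((k : SL O (2 * l)) : Matrix (Fin 2) (Fin 2) (Quo O (2 * l))) - 1) i j) = 0 := by
  have h := congrArg (fun g : SL O l => (g : Matrix (Fin 2) (Fin 2) (Quo O l)) i j)
    (MonoidHom.mem_ker.mp k.2)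
  rw [Matrix.sub_apply, map_sub]
  have h' : red O (by omega : l ≤ 2 * l) ((k : SL O (2 * l)).1 i j) =
      (1 : Matrix (Fin 2) (Fin 2) (Quo O l)) i j := h
  rw [sub_eq_zero]
  refine h'.trans ?_
  rw [Matrix.one_apply, Matrix.one_apply]
  split_ifs <;> simp

/-- The restriction `ψ_[A]` of `ψ_A` to `K^ℓ ⊆ SL₂(𝔬_{2ℓ})`. As `π^ℓ B = k - I` for
`k = I + π^ℓ B`, the value `ψ (π^ℓ tr (Â B))` at `k` is written without `π` and `B` as
`ψ (tr (Â (k - I)))`; see `psiClass_apply` and `psiClass_eq`. -/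
def psiClass (ψ : AddChar (Quo O (2 * l)) ℂ) (A : Matrix (Fin 2) (Fin 2) (Quo O l)) :
    congruenceSubgroup O (by omega : l ≤ 2 * l) →* ℂ where
  toFun k := ψ (Matrix.trace (lift A *
    (((k : SL O (2 * l)) : Matrix (Fin 2) (Fin 2) (Quo O (2 * l))) - 1)))
  map_one' := by simp
  map_mul' k k' := by
    have h0 : ((((k : SL O (2 * l)) : Matrix (Fin 2) (Fin 2) (Quo O (2 * l))) - 1) *
        (((k' : SL O (2 * l)) : Matrix (Fin 2) (Fin 2) (Quo O (2 * l))) - 1)) = 0 := by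
      ext i j
      rw [Matrix.mul_apply]
      exact Finset.sum_eq_zero fun t _ => mul_eq_zero_of_red (red_sub_one k i t)
        (red_sub_one k' t j)
    rw [← AddChar.map_add_eq_mul, ← Matrix.trace_add, ← mul_add]
    congr 3
    rw [← sub_eq_zero, ← h0]
    have h1 : (((k * k' : congruenceSubgroup O (by omega : l ≤ 2 * l)) : SL O (2 * l)) :
        Matrix (Fin 2) (Fin 2) (Quo O (2 * l))) =
        ((k : SL O (2 * l)) : Matrix (Fin 2) (Fin 2) (Quo O (2 * l))) *
          ((k' : SL O (2 * l)) : Matrix (Fin 2) (Fin 2) (Quo O (2 * l))) := rfl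
    rw [h1]
    noncomm_ring

/-- The value of `ψ_[A]` does not depend on the lift of `A`. -/
theorem psiClass_apply (ψ : AddChar (Quo O (2 * l)) ℂ)
    (A : Matrix (Fin 2) (Fin 2) (Quo O l)) (A' : Matrix (Fin 2) (Fin 2) (Quo O (2 * l)))
    (hA : A'.map (red O (by omega : l ≤ 2 * l)) = A)
    (k : congruenceSubgroup O (by omega : l ≤ 2 * l)) :
    psiClass ψ A k = ψ (Matrix.trace (A' *
      (((k : SL O (2 * l)) : Matrix (Fin 2) (Fin 2) (Quo O (2 * l))) - 1))) := by
  have h0 : (lift A - A') *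
      (((k : SL O (2 * l)) : Matrix (Fin 2) (Fin 2) (Quo O (2 * l))) - 1) = 0 := by
    ext i j
    rw [Matrix.mul_apply]
    refine Finset.sum_eq_zero fun t _ => mul_eq_zero_of_red ?_ (red_sub_one k t j)
    have h1 := congrFun (congrFun ((lift_map A).trans hA.symm) i) t
    rw [Matrix.sub_apply, map_sub, sub_eq_zero]
    exact h1
  rw [sub_mul, sub_eq_zero] at h0
  rw [← h0]
  rfl

/-- The defining formula `ψ_A (I + π^ℓ B) = ψ (π^ℓ tr (Â B))`, for any lift `Â` of `A`. -/
theorem psiClass_eq (ψ : AddChar (Quo O (2 * l)) ℂ) (π : O)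
    (A : Matrix (Fin 2) (Fin 2) (Quo O l)) (A' B : Matrix (Fin 2) (Fin 2) (Quo O (2 * l)))
    (hA : A'.map (red O (by omega : l ≤ 2 * l)) = A)
    (k : congruenceSubgroup O (by omega : l ≤ 2 * l))
    (hk : ((k : SL O (2 * l)) : Matrix (Fin 2) (Fin 2) (Quo O (2 * l))) =
      1 + (Ideal.Quotient.mk (maximalIdeal O ^ (2 * l)) π) ^ l • B) :
    psiClass ψ A k =
      ψ ((Ideal.Quotient.mk (maximalIdeal O ^ (2 * l)) π) ^ l * Matrix.trace (A' * B)) := by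
  rw [psiClass_apply ψ A A' hA, hk, add_sub_cancel_left, Matrix.mul_smul, Matrix.trace_smul,
    smul_eq_mul]

end Characters

section Representations

/-- A one dimensional character `χ` of `H` as a representation of `H` on `ℂ`. -/
def charRep {H : Type*} [Group H] (χ : H →* ℂ) : Representation ℂ H ℂ :=
  (algebraMap ℂ (Module.End ℂ ℂ)).toMonoidHom.comp χ

/-- The twist `ρ ⊗ χ` of a representation by a one dimensional character. -/
def twist {G V : Type*} [Group G] [AddCommGroup V] [Module ℂ V]
    (ρ : Representation ℂ G V) (χ : G →* ℂ) : Representation ℂ G V where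
  toFun g := χ g • ρ g
  map_one' := by simp
  map_mul' g h := by rw [map_mul, map_mul, smul_mul_smul_comm]

/-- `ρ ∈ Irr(G | χ)`: `ρ` is irreducible and is isomorphic to a subrepresentation of
`Ind_H^G χ`, where `χ` is a one dimensional character of the subgroup `H` of `G`. -/
def IsIrrAbove {G V : Type*} [Group G] [AddCommGroup V] [Module ℂ V]
    (ρ : Representation ℂ G V) {H : Subgroup G} (χ : H →* ℂ) : Prop :=
  ρ.IsIrreducible ∧
    ∃ f : ρ.IntertwiningMap (Representation.ind H.subtype (charRep χ)), Function.Injective f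

/-- A representation of `SL₂(𝔬_r)` is primitive if neither it nor any of its twists is trivial
on the congruence subgroup `K^(r-1)`. -/
def IsPrimitive {O : Type*} [CommRing O] [IsLocalRing O] {r : ℕ} {V : Type*} [AddCommGroup V]
    [Module ℂ V] (ρ : Representation ℂ (SL O r) V) : Prop :=
  (¬ ∀ k ∈ congruenceSubgroup O (Nat.sub_le r 1), ρ k = 1) ∧
    ∀ χ : SL O r →* ℂ, ¬ ∀ k ∈ congruenceSubgroup O (Nat.sub_le r 1), twist ρ χ k = 1

/-- Isomorphism of the primitive irreducible representations of `SL₂(𝔬_r)` on `ℂ ^ d`. -/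
def primitiveSetoid (O : Type*) [CommRing O] [IsLocalRing O] (r d : ℕ) :
    Setoid {ρ : Representation ℂ (SL O r) (Fin d → ℂ) // ρ.IsIrreducible ∧ IsPrimitive ρ} where
  r ρ σ := Nonempty (ρ.1.Equiv σ.1)
  iseqv :=
    { refl := fun ρ => ⟨Representation.Equiv.refl ρ.1⟩
      symm := fun ⟨e⟩ => ⟨e.symm⟩
      trans := fun ⟨e⟩ ⟨f⟩ => ⟨e.trans f⟩ }

/-- The number of inequivalent primitive irreducible representations of `SL₂(𝔬_r)` of
dimension `d`. -/
def numPrimitive (O : Type*) [CommRing O] [IsLocalRing O] (r d : ℕ) : ℕ :=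
  Nat.card (Quotient (primitiveSetoid O r d))

end Representations

end SLTwo

end

/-!
An irreducible representation `ρ` of `SL₂(𝔬_{2ℓ})`, restricted to the abelian subgroup `K^ℓ`,
contains some `ψ_[A]`, and `A` is cyclic if `ρ` is primitive.

If `Ā` has two distinct eigenvalues in `𝔽_q`, then `A` can be diagonalized, and since `e < ℓ` the
stabilizer of `ψ_[A]` is the group of matrices that are diagonal modulo `π ^ ℓ`. So `ρ` is induced
from a character `g ↦ τ (g₀₀)` of this group, whose index is `(q + 1) q ^ (2ℓ - 1)`. The character
`τ` of `𝔬_{2ℓ}ˣ` is nontrivial on `1 + ℘ ^ (2ℓ - 1)` and is determined by `ρ` up to inversion, which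
the Weyl element realizes. Hence the number sought is half the number of such `τ`.

Otherwise the stabilizer in `SL₂` is hard to control when `q` is even, and one passes to `GL₂`,
where the stabilizer of `ψ_A` is the product of the congruence kernel with the lifts of the
centralizer of `A`, and acts on the `ψ_A`-eigenspace through commuting operators. This bounds
`dim ρ` by the index of the centralizer of `A` in `GL₂(𝔬_ℓ)`, which is at most
`(q ^ 2 - 1) q ^ (2ℓ - 2) < (q + 1) q ^ (2ℓ - 1)`.
-/

open scoped Matrix MatrixGroups

noncomputable section

namespace SLTwo

open IsLocalRing
open Matrix.SpecialLinearGroup (coeMonoidHom coeMonoidHom_injective toGL toGL_injective)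

/-! ### Representations of finite groups -/

section CommonEigenvectors

open Module

variable {𝕜 V ι : Type*} [Field 𝕜] [IsAlgClosed 𝕜] [AddCommGroup V] [Module 𝕜 V]
  [FiniteDimensional 𝕜 V]

theorem exists_common_eigenvector [Nontrivial V] (T : ι → End 𝕜 V)
    (hT : ∀ i j, T i * T j = T j * T i) : ∃ v : V, v ≠ 0 ∧ ∀ i, ∃ c : 𝕜, T i v = c • v := by
  let A := Algebra.adjoin 𝕜 (Set.range T)
  have : IsMulCommutative A := Algebra.isMulCommutative_adjoin 𝕜 (by
    rintro _ ⟨i, rfl⟩ _ ⟨j, rfl⟩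
    exact hT i j)
  have : IsArtinian A V := isArtinian_of_tower 𝕜 inferInstance
  obtain ⟨E, hE, -⟩ := (eq_bot_or_exists_atom_le (⊤ : Submodule A V)).resolve_left top_ne_bot
  have : IsSimpleModule A E := isSimpleModule_iff_isAtom.2 hE
  have : IsSimpleModule A (E.restrictScalars 𝕜) :=
    inferInstanceAs (IsSimpleModule A E)
  have hE1 : finrank 𝕜 (E.restrictScalars 𝕜) = 1 :=
    IsSimpleModule.finrank_eq_one_of_isMulCommutative A (E.restrictScalars 𝕜) 𝕜
  obtain ⟨v, hv, hspan⟩ := finrank_eq_one_iff'.1 hE1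
  refine ⟨v, fun h => hv (Subtype.ext h), fun i => ?_⟩
  have hmem : T i v ∈ E := E.smul_mem ⟨T i, Algebra.subset_adjoin ⟨i, rfl⟩⟩ v.2
  obtain ⟨c, hc⟩ := hspan ⟨T i v, hmem⟩
  exact ⟨c, congrArg Subtype.val hc.symm⟩

theorem exists_common_eigenvector_mem (T : ι → End 𝕜 V) {E : Submodule 𝕜 V} (hE : E ≠ ⊥)
    (hstable : ∀ i, ∀ v ∈ E, T i v ∈ E) (hT : ∀ i j, ∀ v ∈ E, T i (T j v) = T j (T i v)) :
    ∃ v ∈ E, v ≠ 0 ∧ ∀ i, ∃ c : 𝕜, T i v = c • v := by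
  have : Nontrivial E := Submodule.nontrivial_iff_ne_bot.2 hE
  obtain ⟨v, hv, h⟩ := exists_common_eigenvector (fun i => (T i).restrict (hstable i))
    fun i j => LinearMap.ext fun v => Subtype.ext (hT i j v v.2)
  exact ⟨v, v.2, fun h0 => hv (Subtype.ext h0),
    fun i => (h i).imp fun c hc => congrArg Subtype.val hc⟩

theorem exists_character {H : Type*} [Monoid H] {𝕜 V : Type*} [Field 𝕜] [AddCommGroup V]
    [Module 𝕜 V] (ρ : Representation 𝕜 H V) {v : V} (h0 : v ≠ 0)
    (h : ∀ x, ∃ c : 𝕜, ρ x v = c • v) : ∃ χ : H →* 𝕜, ∀ x, ρ x v = χ x • v := by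
  choose c hc using h
  have hinj := smul_left_injective 𝕜 h0
  refine ⟨⟨⟨c, hinj ?_⟩, fun x y => hinj ?_⟩, hc⟩
  · exact (hc 1).symm.trans (by rw [map_one]; exact (one_smul 𝕜 v).symm)
  · exact (hc _).symm.trans (by rw [map_mul, End.mul_apply, hc, map_smul, hc, smul_smul, mul_comm])

end CommonEigenvectors

section Irreducible

open Module Representation
open scoped MonoidAlgebra

variable {𝕜 G V W : Type*} [Field 𝕜] [Group G] [AddCommGroup V] [Module 𝕜 V]
  [AddCommGroup W] [Module 𝕜 W] (ρ : Representation 𝕜 G V) (σ : Representation 𝕜 G W)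

/-- The subrepresentation generated by a vector. -/
def cyclicSub (v : V) : Subrepresentation ρ where
  toSubmodule := Submodule.span 𝕜 (Set.range fun g => ρ g v)
  apply_mem_toSubmodule g := by
    refine (Submodule.span_le (p := (Submodule.span 𝕜 _).comap (ρ g))).2 ?_
    rintro _ ⟨h, rfl⟩
    exact Submodule.subset_span ⟨g * h, by simp only [map_mul, End.mul_apply]⟩

theorem self_mem_cyclicSub (v : V) : v ∈ (cyclicSub ρ v).toSubmodule :=
  Submodule.subset_span ⟨1, by simp only [map_one, End.one_apply]⟩

theorem finrank_cyclicSub_le {v : V} (S : Subgroup G) [S.FiniteIndex]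
    (hS : ∀ s ∈ S, ∃ c : 𝕜, ρ s v = c • v) :
    finrank 𝕜 (cyclicSub ρ v).toSubmodule ≤ S.index := by
  have : Fintype (G ⧸ S) := Subgroup.fintypeQuotientOfFiniteIndex
  have hspan : (cyclicSub ρ v).toSubmodule ≤
      Submodule.span 𝕜 (Set.range fun x : G ⧸ S => ρ x.out v) := by
    refine Submodule.span_le.2 ?_
    rintro _ ⟨g, rfl⟩
    obtain ⟨s, hs⟩ := QuotientGroup.mk_out_eq_mul S g
    obtain ⟨c, hc⟩ := hS _ (S.inv_mem s.2)
    have hg : ρ g v = c • ρ (g : G ⧸ S).out v := by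
      rw [← map_smul, ← hc, ← End.mul_apply, ← map_mul, hs, mul_inv_cancel_right]
    refine Set.mem_of_eq_of_mem hg ?_
    exact Submodule.smul_mem _ c (Submodule.subset_span ⟨(g : G ⧸ S), rfl⟩)
  have := FiniteDimensional.span_of_finite 𝕜 (Set.finite_range fun x : G ⧸ S => ρ x.out v)
  rw [Subgroup.index, Nat.card_eq_fintype_card]
  exact (Submodule.finrank_mono hspan).trans (finrank_range_le_card _)

theorem nontrivial_of_isIrreducible [ρ.IsIrreducible] : Nontrivial V :=
  IsSimpleModule.nontrivial 𝕜[G] ρ.asModule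

theorem cyclicSub_eq_top [ρ.IsIrreducible] {v : V} (hv : v ≠ 0) : cyclicSub ρ v = ⊤ := by
  refine (eq_bot_or_eq_top _).resolve_left fun h => hv ?_
  exact (Submodule.mem_bot 𝕜).1 (h ▸ self_mem_cyclicSub ρ v : v ∈ (⊥ : Subrepresentation ρ))

theorem finrank_le_index [ρ.IsIrreducible] {v : V} (hv : v ≠ 0) (S : Subgroup G) [S.FiniteIndex]
    (hS : ∀ s ∈ S, ∃ c : 𝕜, ρ s v = c • v) : finrank 𝕜 V ≤ S.index := by
  have h := finrank_cyclicSub_le ρ S hS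
  rw [cyclicSub_eq_top ρ hv] at h
  exact finrank_top 𝕜 V ▸ h

variable {ρ σ}

theorem surjective_of_apply_ne_zero [σ.IsIrreducible] (f : ρ.IntertwiningMap σ) {v : V}
    (hv : f v ≠ 0) : Function.Surjective f :=
  (IsIrreducible.surjective_or_eq_zero f).resolve_right fun h => hv (DFunLike.congr_fun h v)

/-- The inclusion of a subrepresentation as an intertwining map. -/
def subrepresentationSubtype (N : Subrepresentation ρ) : N.toRepresentation.IntertwiningMap ρ :=
  ⟨N.toSubmodule.subtype, fun _ => rfl⟩

/-- Subrepresentations of a subrepresentation `N` of `ρ` are subrepresentations of `ρ` contained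
in `N`. -/
def subrepresentationOrderIsoIic (N : Subrepresentation ρ) :
    Subrepresentation N.toRepresentation ≃o Set.Iic N where
  toFun M := ⟨⟨M.toSubmodule.map N.toSubmodule.subtype, by
      rintro g _ ⟨x, hx, rfl⟩
      exact ⟨_, M.apply_mem_toSubmodule g hx, rfl⟩⟩,
    Submodule.map_subtype_le N.toSubmodule M.toSubmodule⟩
  invFun K := ⟨K.1.toSubmodule.comap N.toSubmodule.subtype,
    fun g _ hx => K.1.apply_mem_toSubmodule g hx⟩
  left_inv M := Subrepresentation.toSubmodule_injective <|
    Submodule.comap_map_eq_of_injective N.toSubmodule.subtype_injective M.toSubmodule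
  right_inv K := Subtype.ext <| Subrepresentation.toSubmodule_injective <|
    (Submodule.map_comap_subtype _ _).trans (inf_eq_right.2 K.2)
  map_rel_iff' := Submodule.map_le_map_iff_of_injective N.toSubmodule.subtype_injective _ _

theorem isIrreducible_of_isAtom {N : Subrepresentation ρ} (hN : IsAtom N) :
    N.toRepresentation.IsIrreducible :=
  (subrepresentationOrderIsoIic N).isSimpleOrder_iff.2 (Set.isSimpleOrder_Iic_iff_isAtom.2 hN)

theorem exists_isAtom_isIrreducible (ρ : Representation 𝕜 G V) [IsSemisimpleRepresentation ρ]
    [Nontrivial V] : ∃ N : Subrepresentation ρ, IsAtom N ∧ N.toRepresentation.IsIrreducible := by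
  have : IsSemisimpleModule 𝕜[G] ρ.asModule :=
    (isSemisimpleRepresentation_iff_isSemisimpleModule_asModule ρ).1 inferInstance
  have : IsAtomic (Subrepresentation ρ) :=
    Subrepresentation.subrepresentationSubmoduleOrderIso.isAtomic_iff.2 inferInstance
  have : Nontrivial (Subrepresentation ρ) :=
    have : Nontrivial ρ.asModule := ‹Nontrivial V›
    Subrepresentation.subrepresentationSubmoduleOrderIso.toEquiv.nontrivial
  obtain ⟨N, hN, -⟩ := (eq_bot_or_exists_atom_le (⊤ : Subrepresentation ρ)).resolve_left top_ne_bot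
  exact ⟨N, hN, isIrreducible_of_isAtom hN⟩

theorem exists_leftInverse_of_injective [IsSemisimpleRepresentation σ]
    (f : ρ.IntertwiningMap σ) (hf : Function.Injective f) :
    ∃ g : σ.IntertwiningMap ρ, ∀ v, g (f v) = v := by
  have : IsSemisimpleModule 𝕜[G] σ.asModule :=
    (isSemisimpleRepresentation_iff_isSemisimpleModule_asModule σ).1 inferInstance
  obtain ⟨g, hg⟩ := IsSemisimpleModule.extension_property
    (IntertwiningMap.equivLinearMapAsModule ρ σ f) hf LinearMap.id
  exact ⟨(IntertwiningMap.equivLinearMapAsModule σ ρ).symm g, LinearMap.congr_fun hg⟩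

theorem exists_rightInverse_of_surjective [IsSemisimpleRepresentation ρ]
    (f : ρ.IntertwiningMap σ) (hf : Function.Surjective f) :
    ∃ g : σ.IntertwiningMap ρ, ∀ w, f (g w) = w := by
  have : IsSemisimpleModule 𝕜[G] ρ.asModule :=
    (isSemisimpleRepresentation_iff_isSemisimpleModule_asModule ρ).1 inferInstance
  obtain ⟨g, hg⟩ := IsSemisimpleModule.lifting_property
    (IntertwiningMap.equivLinearMapAsModule ρ σ f) hf LinearMap.id
  exact ⟨(IntertwiningMap.equivLinearMapAsModule σ ρ).symm g, LinearMap.congr_fun hg⟩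

theorem isIrreducible_of_equiv [ρ.IsIrreducible] (e : ρ.Equiv σ) : σ.IsIrreducible :=
  (irreducible_iff_isSimpleModule_asModule σ).2 <| IsSimpleModule.congr <|
    LinearEquiv.ofBijective (IntertwiningMap.equivLinearMapAsModule σ ρ e.symm.toIntertwiningMap)
      e.symm.toLinearEquiv.bijective

theorem isIrreducible_of_finrank_eq_one (h : finrank 𝕜 V = 1) : ρ.IsIrreducible where
  exists_pair_ne :=
    have := nontrivial_of_finrank_eq_succ h
    ⟨⊥, ⊤, fun h => bot_ne_top (α := Submodule 𝕜 V) (congrArg Subrepresentation.toSubmodule h)⟩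
  eq_bot_or_eq_top N :=
    have := is_simple_module_of_finrank_eq_one (A := 𝕜) h
    (eq_bot_or_eq_top N.toSubmodule).imp (fun h => Subrepresentation.toSubmodule_injective h)
      fun h => Subrepresentation.toSubmodule_injective h

theorem exists_equiv_fin [FiniteDimensional 𝕜 V] (ρ : Representation 𝕜 G V) :
    ∃ σ : Representation 𝕜 G (Fin (finrank 𝕜 V) → 𝕜), Nonempty (ρ.Equiv σ) := by
  let e : V ≃ₗ[𝕜] (Fin (finrank 𝕜 V) → 𝕜) := (finBasis 𝕜 V).equivFun
  refine ⟨e.conjRingEquiv.toMonoidHom.comp ρ, ⟨Representation.Equiv.mk e fun g => ?_⟩⟩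
  ext v : 1
  exact congrArg (fun w => e (ρ g w)) (e.symm_apply_apply v).symm

end Irreducible

section Weights

open Module Representation

variable {𝕜 G V W : Type*} [Field 𝕜] [Group G] [AddCommGroup V] [Module 𝕜 V]
  [AddCommGroup W] [Module 𝕜 W] {ρ : Representation 𝕜 G V} {σ : Representation 𝕜 G W}

/-- The one-dimensional character `χ` of the subgroup `S` occurs in the restriction of `ρ`
to `S`. -/
def HasWeight (ρ : Representation 𝕜 G V) {S : Subgroup G} (χ : S →* 𝕜) : Prop :=
  ∃ v ≠ 0, ∀ s : S, ρ s v = χ s • v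

theorem HasWeight.map {S : Subgroup G} {χ : S →* 𝕜} (h : HasWeight ρ χ)
    (f : ρ.IntertwiningMap σ) (hf : Function.Injective f) : HasWeight σ χ := by
  obtain ⟨v, hv, hχ⟩ := h
  refine ⟨f v, (map_ne_zero_iff f hf).2 hv, fun s => ?_⟩
  rw [← f.isIntertwining, hχ, map_smul]

theorem nonempty_equiv_of_hasWeight [ρ.IsIrreducible] [σ.IsIrreducible] [FiniteDimensional 𝕜 V]
    [FiniteDimensional 𝕜 W] {S : Subgroup G} [S.FiniteIndex] {χ : S →* 𝕜} (hρ : HasWeight ρ χ)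
    (hσ : HasWeight σ χ) (hV : finrank 𝕜 V = S.index) (hW : finrank 𝕜 W = S.index) :
    Nonempty (ρ.Equiv σ) := by
  obtain ⟨v, hv, hχv⟩ := hρ
  obtain ⟨w, hw, hχw⟩ := hσ
  let U := cyclicSub (ρ.prod σ) (v, w)
  have hU : finrank 𝕜 U.toSubmodule ≤ S.index :=
    finrank_cyclicSub_le _ S fun s hs => ⟨χ ⟨s, hs⟩, Prod.ext (hχv ⟨s, hs⟩) (hχw ⟨s, hs⟩)⟩
  let u : U.toSubmodule := ⟨(v, w), self_mem_cyclicSub _ _⟩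
  let f := (IntertwiningMap.fst 𝕜 ρ σ).comp (subrepresentationSubtype U)
  let g := (IntertwiningMap.snd 𝕜 ρ σ).comp (subrepresentationSubtype U)
  have hf : Function.Surjective f := surjective_of_apply_ne_zero f (v := u) hv
  have hg : Function.Surjective g := surjective_of_apply_ne_zero g (v := u) hw
  have hUV : finrank 𝕜 U.toSubmodule = finrank 𝕜 V := le_antisymm (hU.trans hV.ge)
    (LinearMap.finrank_le_finrank_of_surjective (f := f.toLinearMap) hf)
  have hf' : Function.Injective f :=
    (LinearMap.injective_iff_surjective_of_finrank_eq_finrank (f := f.toLinearMap) hUV).2 hf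
  have hg' : Function.Injective g :=
    (LinearMap.injective_iff_surjective_of_finrank_eq_finrank (f := g.toLinearMap)
      (hUV.trans (hV.trans hW.symm))).2 hg
  exact ⟨(f.ofBijective ⟨hf', hf⟩).symm.trans (g.ofBijective ⟨hg', hg⟩)⟩

end Weights

section Induction

open Module Representation

variable {𝕜 G H V W : Type*} [Field 𝕜] [Group G] [Group H] [AddCommGroup V] [Module 𝕜 V]
  [AddCommGroup W] [Module 𝕜 W] (ι : G →* H) (ρ : Representation 𝕜 G V)
  {σ : Representation 𝕜 H W}

theorem ind_apply_mk_one (g : G) (v : V) :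
    ind ι ρ (ι g) (IndV.mk ι ρ 1 v) = IndV.mk ι ρ 1 (ρ g v) := by
  have h : IndV.mk ι ρ (ι g * (ι g)⁻¹) (ρ g v) = IndV.mk ι ρ (ι g)⁻¹ v := by
    simpa using Coinvariants.mk_self_apply (tprod ((leftRegular 𝕜 H).comp ι) ρ) g
      (TensorProduct.tmul 𝕜 (MonoidAlgebra.single (ι g)⁻¹ 1) v)
  rw [ind_mk, one_mul, ← h, mul_inv_cancel]

variable {ι ρ} in
theorem exists_apply_mk_one_ne_zero {f : (ind ι ρ).IntertwiningMap σ} (hf : f ≠ 0) :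
    ∃ v, f (IndV.mk ι ρ 1 v) ≠ 0 := by
  contrapose! hf
  refine IntertwiningMap.ext (IndV.hom_ext ι ρ fun h => LinearMap.ext fun v => ?_)
  have hh : IndV.mk ι ρ h v = ind ι ρ h⁻¹ (IndV.mk ι ρ 1 v) := by
    rw [ind_mk, one_mul, inv_inv]
  refine (congrArg f hh).trans ?_
  rw [f.isIntertwining, hf, map_zero]
  rfl

theorem IsIrrAbove.hasWeight {V : Type*} [AddCommGroup V] [Module ℂ V] [Finite G]
    {ρ : Representation ℂ G V} {S : Subgroup G} {χ : S →* ℂ} (h : IsIrrAbove ρ χ) :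
    HasWeight ρ χ := by
  obtain ⟨_, f, hf⟩ := h
  obtain ⟨g, hg⟩ := exists_leftInverse_of_injective f hf
  have hg0 : g ≠ 0 := by
    rintro rfl
    have := nontrivial_of_isIrreducible ρ
    obtain ⟨v, hv⟩ := exists_ne (0 : V)
    exact hv (hg v).symm
  obtain ⟨z, hz⟩ := exists_apply_mk_one_ne_zero hg0
  refine ⟨_, hz, fun s => ?_⟩
  rw [← g.isIntertwining, ← map_smul, ← map_smul]
  exact congrArg g (ind_apply_mk_one S.subtype (charRep χ) s z)

/-- Evaluation at `1` on the coinduced representation. -/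
def coindEval : IntertwiningMap ((coind ι ρ).comp ι) ρ where
  toLinearMap := LinearMap.proj 1 ∘ₗ (coindV ι ρ).subtype
  isIntertwining' g := LinearMap.ext fun f =>
    (congrArg f.1 ((one_mul (ι g)).trans (mul_one (ι g)).symm)).trans (f.2 g 1)

theorem coindEval_apply (f : coindV ι ρ) (h : H) : coindEval ι ρ (coind ι ρ h f) = f.1 h :=
  congrArg f.1 (one_mul h)

variable {ι} in
theorem nontrivial_coindV (hι : Function.Injective ι) [Nontrivial V] :
    Nontrivial (coindV ι ρ) := by
  obtain ⟨v, hv⟩ := exists_ne (0 : V)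
  set F : H → V := Function.extend ι (fun g => ρ g v) 0 with hFdef
  have hF : F ∈ coindV ι ρ := by
    intro g h
    by_cases hh : ∃ g', ι g' = h
    · obtain ⟨g', rfl⟩ := hh
      rw [hFdef, ← map_mul, hι.extend_apply, hι.extend_apply, map_mul, End.mul_apply]
    · have hgh : ¬ ∃ g', ι g' = ι g * h := fun ⟨g', hg'⟩ =>
        hh ⟨g⁻¹ * g', by rw [map_mul, hg', map_inv, inv_mul_cancel_left]⟩
      rw [hFdef, Function.extend_apply' _ _ _ hgh, Function.extend_apply' _ _ _ hh]
      exact (map_zero _).symm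
  refine ⟨⟨F, hF⟩, 0, fun h => hv ?_⟩
  have h1 : F (ι 1) = 0 := congrFun (congrArg Subtype.val h) (ι 1)
  rwa [hFdef, hι.extend_apply, map_one, End.one_apply] at h1

variable {ι ρ} in
theorem exists_coindEval_ne_zero {N : Subrepresentation (coind ι ρ)} (hN : N ≠ ⊥) :
    ∃ f ∈ N, coindEval ι ρ f ≠ 0 := by
  contrapose! hN
  refine Subrepresentation.toSubmodule_injective ((Submodule.eq_bot_iff _).2 fun f hf => ?_)
  refine Subtype.ext (funext fun h => ?_)
  rw [← coindEval_apply]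
  exact hN _ (N.apply_mem_toSubmodule h hf)

theorem exists_isIrreducible_extending [Finite H] [NeZero (Nat.card H : 𝕜)]
    (hι : Function.Injective ι) [ρ.IsIrreducible] [FiniteDimensional 𝕜 V] :
    ∃ (d : ℕ) (σ : Representation 𝕜 H (Fin d → 𝕜)) (f : IntertwiningMap ρ (σ.comp ι)),
      σ.IsIrreducible ∧ Function.Injective f := by
  have : Finite G := Finite.of_injective ι hι
  have : NeZero (Nat.card G : 𝕜) := ⟨fun h => NeZero.ne (Nat.card H : 𝕜) <| by
    obtain ⟨n, hn⟩ := Subgroup.card_dvd_of_injective ι hι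
    rw [hn, Nat.cast_mul, h, zero_mul]⟩
  have := nontrivial_of_isIrreducible ρ
  have := nontrivial_coindV ρ hι
  obtain ⟨N, hN, _⟩ := exists_isAtom_isIrreducible (coind ι ρ)
  obtain ⟨w, hwN, hw⟩ := exists_coindEval_ne_zero hN.1
  obtain ⟨σ, ⟨e⟩⟩ := exists_equiv_fin (V := N.toSubmodule) N.toRepresentation
  let j := (subrepresentationSubtype N).comp e.symm.toIntertwiningMap
  let f : IntertwiningMap (σ.comp ι) ρ :=
    (coindEval ι ρ).comp ⟨j.toLinearMap, fun g => LinearMap.ext (j.isIntertwining _ _ (ι g))⟩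
  have hf : f (e ⟨w, hwN⟩) ≠ 0 := by
    change coindEval ι ρ (e.symm (e ⟨w, hwN⟩)).1 ≠ 0
    rwa [e.symm_apply_apply]
  obtain ⟨s, hs⟩ := exists_rightInverse_of_surjective f (surjective_of_apply_ne_zero f hf)
  exact ⟨_, σ, s, isIrreducible_of_equiv (V := N.toSubmodule) e, Function.LeftInverse.injective hs⟩

theorem exists_isIrreducible_hasWeight [Finite G] [NeZero (Nat.card G : 𝕜)] (S : Subgroup G)
    (χ : S →* 𝕜) : ∃ (d : ℕ) (σ : Representation 𝕜 G (Fin d → 𝕜)),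
      σ.IsIrreducible ∧ HasWeight σ χ := by
  let ρ : Representation 𝕜 S 𝕜 := (algebraMap 𝕜 (End 𝕜 𝕜)).toMonoidHom.comp χ
  have : ρ.IsIrreducible := isIrreducible_of_finrank_eq_one (finrank_self 𝕜)
  obtain ⟨d, σ, f, hσ, hf⟩ := exists_isIrreducible_extending S.subtype ρ S.subtype_injective
  refine ⟨d, σ, hσ, f 1, (map_ne_zero_iff f hf).2 one_ne_zero, fun s => ?_⟩
  rw [← map_smul]
  exact (f.isIntertwining _ _ s 1).symm

end Induction

/-! ### Eigencharacters of the congruence kernel -/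

section CommutantMod

variable {R S : Type*} [CommRing R] [Ring S] [Algebra R S] {p : R} {a b : S}

/-- The elements commuting with `a` modulo the annihilator of `p`. -/
def commutantMod (p : R) (a : S) : Subalgebra R S where
  carrier := {b | p • (b * a) = p • (a * b)}
  mul_mem' {b c} hb hc := by
    have hb : p • (b * a) = p • (a * b) := hb
    have hc : p • (c * a) = p • (a * c) := hc
    change p • (b * c * a) = p • (a * (b * c))
    rw [mul_assoc, ← mul_smul_comm, hc, mul_smul_comm, ← mul_assoc, ← smul_mul_assoc, hb,
      smul_mul_assoc, mul_assoc]
  add_mem' {b c} hb hc := by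
    change p • ((b + c) * a) = p • (a * (b + c))
    rw [add_mul, mul_add, smul_add, smul_add, hb, hc]
  algebraMap_mem' r := congrArg (p • ·) (Algebra.commutes r a)

theorem mem_commutantMod : b ∈ commutantMod p a ↔ p • (b * a) = p • (a * b) := Iff.rfl

theorem mem_commutantMod_comm : b ∈ commutantMod p a ↔ a ∈ commutantMod p b := eq_comm

theorem adjoin_le_commutantMod (h : b ∈ commutantMod p a) :
    Algebra.adjoin R {a} ≤ commutantMod p b :=
  Algebra.adjoin_le (Set.singleton_subset_iff.2 (mem_commutantMod_comm.1 h))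

theorem mem_commutantMod_of_mul_eq_one {b' : S} (hb : b ∈ commutantMod p a) (h : b * b' = 1)
    (h' : b' * b = 1) : b' ∈ commutantMod p a :=
  calc p • (b' * a) = b' * (p • (a * b)) * b' := by
        rw [mul_smul_comm, smul_mul_assoc, mul_assoc, mul_assoc, h, mul_one]
    _ = p • (a * b') := by
        rw [← mem_commutantMod.1 hb, mul_smul_comm, smul_mul_assoc, ← mul_assoc, h', one_mul]

theorem smul_mem_commutantMod (hp : p * p = 0) (b : S) : p • b ∈ commutantMod p a := by
  rw [mem_commutantMod, smul_mul_assoc, mul_smul_comm, smul_smul, smul_smul, hp, zero_smul,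
    zero_smul]

theorem mem_commutantMod_of_eq_add_smul (hp : p * p = 0) {c x : S}
    (hc : c ∈ Algebra.adjoin R {a}) (hb : b = c + p • x) : b ∈ commutantMod p a :=
  hb ▸ add_mem (adjoin_le_commutantMod (mem_commutantMod.2 rfl) hc) (smul_mem_commutantMod hp x)

end CommutantMod

section Trace

variable {R n : Type*} [CommRing R] [DecidableEq n] {p : R} {A A' : Matrix n n R}

/-- `A` and `A'` differ by a scalar matrix modulo the annihilator of `p`. -/
def CongrModScalar (p : R) (A A' : Matrix n n R) : Prop :=
  ∃ x : R, p • A = p • (A' + x • (1 : Matrix n n R))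

theorem congrModScalar_of_entries (hoff : ∀ i j, i ≠ j → p * A i j = p * A' i j)
    (hdiag : ∀ i j, p * (A i i - A' i i) = p * (A j j - A' j j)) : CongrModScalar p A A' := by
  cases isEmpty_or_nonempty n with
  | inl _ => exact ⟨0, Matrix.ext fun i => isEmptyElim i⟩
  | inr h =>
    obtain ⟨k⟩ := h
    refine ⟨A k k - A' k k, Matrix.ext fun i j => ?_⟩
    rcases eq_or_ne i j with rfl | hij
    · simp only [Matrix.smul_apply, Matrix.add_apply, Matrix.one_apply_eq, smul_eq_mul, mul_one]
      linear_combination hdiag i k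
    · simp only [Matrix.smul_apply, Matrix.add_apply, Matrix.one_apply_ne hij, smul_eq_mul,
        mul_zero, add_zero, hoff i j hij]

variable [Fintype n]

theorem det_one_add_smul_of_mul_self_eq_zero (hp : p * p = 0) (B : Matrix n n R) :
    (1 + p • B).det = 1 + p * B.trace := by
  rw [Matrix.det_one_add_smul, sq, hp, mul_zero, add_zero, mul_comm]

theorem mul_trace_mul_comm_sub_eq_zero {C K : Matrix n n R} (h : C ∈ commutantMod p K)
    (Z : Matrix n n R) : p * (K * (C * Z - Z * C)).trace = 0 := by
  rw [mul_sub, Matrix.trace_sub, ← mul_assoc, ← mul_assoc, Matrix.trace_mul_comm (K * Z) C,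
    ← mul_assoc, ← Matrix.trace_sub, ← smul_eq_mul, ← Matrix.trace_smul, ← sub_mul,
    ← Matrix.smul_mul, smul_sub, mem_commutantMod.1 h, sub_self, zero_mul, Matrix.trace_zero]

theorem CongrModScalar.conj (h : CongrModScalar p A A') {P Q : Matrix n n R} (hPQ : P * Q = 1) :
    CongrModScalar p (P * A * Q) (P * A' * Q) := by
  obtain ⟨x, hx⟩ := h
  refine ⟨x, ?_⟩
  rw [← Matrix.smul_mul, ← Matrix.mul_smul, hx, Matrix.mul_smul, Matrix.smul_mul, mul_add, add_mul,
    Matrix.mul_smul, Matrix.smul_mul, mul_one, hPQ]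

theorem CongrModScalar.mul_trace (hp : p * p = 0) (h : CongrModScalar p A A') {B : Matrix n n R}
    (hB : (1 + p • B).det = 1) : p * (A * B).trace = p * (A' * B).trace := by
  obtain ⟨x, hx⟩ := h
  rw [det_one_add_smul_of_mul_self_eq_zero hp, add_eq_left] at hB
  calc p * (A * B).trace = ((p • A) * B).trace := by
        rw [Matrix.smul_mul, Matrix.trace_smul, smul_eq_mul]
    _ = p * (A' * B).trace + x * (p * B.trace) := by
        rw [hx, Matrix.smul_mul, add_mul, Matrix.smul_mul, one_mul, Matrix.trace_smul,
          Matrix.trace_add, Matrix.trace_smul, smul_eq_mul, smul_eq_mul, mul_add, mul_left_comm]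
    _ = p * (A' * B).trace := by rw [hB, mul_zero, add_zero]

theorem congrModScalar_of_addChar {𝕜 : Type*} [CommMonoid 𝕜] {ψ : AddChar R 𝕜}
    (hψ : ψ.IsPrimitive) (h : ∀ B : Matrix n n R, B.trace = 0 → ψ (p * ((A - A') * B).trace) = 1) :
    CongrModScalar p A A' := by
  have eq_zero {t : R} (ht : ∀ y, ψ (t * y) = 1) : t = 0 :=
    of_not_not fun h0 => hψ h0 (DFunLike.ext _ _ ht)
  refine congrModScalar_of_entries (fun i j hij => ?_) fun i j => ?_
  · rw [← sub_eq_zero, ← mul_sub, ← Matrix.sub_apply]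
    refine eq_zero fun y => ?_
    have htr := h _ (Matrix.trace_single_eq_of_ne j i y hij.symm)
    rwa [Matrix.trace_mul_single, op_smul_eq_mul, ← mul_assoc] at htr
  · rw [← sub_eq_zero, ← mul_sub, ← Matrix.sub_apply, ← Matrix.sub_apply]
    refine eq_zero fun y => ?_
    have htr := h (Matrix.single i i y - Matrix.single j j y) (by
      rw [Matrix.trace_sub, Matrix.trace_single_eq_same, Matrix.trace_single_eq_same, sub_self])
    rwa [mul_sub, Matrix.trace_sub, Matrix.trace_mul_single, Matrix.trace_mul_single,
      op_smul_eq_mul, op_smul_eq_mul, ← sub_mul, ← mul_assoc] at htr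

end Trace

section CongruenceEigenspace

open Module

variable {R 𝕜 Γ V n : Type*} [CommRing R] [Field 𝕜] [Group Γ] [AddCommGroup V] [Module 𝕜 V]
  [Fintype n] [DecidableEq n]

/-- The vectors on which the elements of `Γ` acting as matrices `I + pB` of determinant one act
through the character `I + pB ↦ ψ (p tr (A B))`. The group `Γ` is one of `SL n R` and `GL n R`,
mapped to the matrices by `μ`. -/
def congruenceEigenspace (μ : Γ →* Matrix n n R) (p : R) (ψ : AddChar R 𝕜)
    (ρ : Representation 𝕜 Γ V) (A : Matrix n n R) : Submodule 𝕜 V where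
  carrier := {v | ∀ γ B, (μ γ).det = 1 → μ γ = 1 + p • B → ρ γ v = ψ (p * (A * B).trace) • v}
  add_mem' h h' γ B hdet hγ := by rw [map_add, h γ B hdet hγ, h' γ B hdet hγ, smul_add]
  zero_mem' γ B _ _ := by rw [map_zero, smul_zero]
  smul_mem' c v h γ B hdet hγ := by rw [map_smul, h γ B hdet hγ, smul_comm]

variable {μ : Γ →* Matrix n n R} {p : R} {ψ : AddChar R 𝕜} {ρ : Representation 𝕜 Γ V}
  {A A' : Matrix n n R} {v : V}

theorem map_mul_map_inv (μ : Γ →* Matrix n n R) (γ : Γ) : μ γ * μ γ⁻¹ = 1 := by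
  rw [← map_mul, mul_inv_cancel, map_one]

theorem map_inv_mul_map (μ : Γ →* Matrix n n R) (γ : Γ) : μ γ⁻¹ * μ γ = 1 := by
  rw [← map_mul, inv_mul_cancel, map_one]

theorem congruenceEigenspace_conj (hv : v ∈ congruenceEigenspace μ p ψ ρ A) (h : Γ) :
    ρ h v ∈ congruenceEigenspace μ p ψ ρ (μ h * A * μ h⁻¹) := by
  intro γ B hdet hγ
  have hconj : μ (h⁻¹ * γ * h) = 1 + p • (μ h⁻¹ * B * μ h) := by
    rw [map_mul, map_mul, hγ, mul_add, add_mul, mul_one, map_inv_mul_map, Matrix.mul_smul,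
      Matrix.smul_mul]
  have hdet' : (μ (h⁻¹ * γ * h)).det = 1 := by
    rw [map_mul, map_mul, Matrix.det_mul, Matrix.det_mul, hdet, mul_one, ← Matrix.det_mul,
      map_inv_mul_map, Matrix.det_one]
  have htrace : (A * (μ h⁻¹ * B * μ h)).trace = (μ h * A * μ h⁻¹ * B).trace := by
    rw [← mul_assoc, ← mul_assoc, Matrix.trace_mul_comm, ← mul_assoc, ← mul_assoc]
  calc ρ γ (ρ h v) = ρ h (ρ (h⁻¹ * γ * h) v) := by
        rw [← End.mul_apply, ← End.mul_apply, ← map_mul, ← map_mul, ← mul_assoc,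
          mul_inv_cancel_left]
    _ = ψ (p * (μ h * A * μ h⁻¹ * B).trace) • ρ h v := by rw [hv _ _ hdet' hconj, map_smul, htrace]

theorem congruenceEigenspace_congr (hp : p * p = 0) (h : CongrModScalar p A A')
    (hv : v ∈ congruenceEigenspace μ p ψ ρ A) : v ∈ congruenceEigenspace μ p ψ ρ A' := by
  intro γ B hdet hγ
  rw [hv γ B hdet hγ, h.mul_trace hp (hγ ▸ hdet)]

theorem apply_mem_congruenceEigenspace (hp : p * p = 0) {h : Γ} (hh : μ h ∈ commutantMod p A)
    (hv : v ∈ congruenceEigenspace μ p ψ ρ A) : ρ h v ∈ congruenceEigenspace μ p ψ ρ A := by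
  refine congruenceEigenspace_congr hp ⟨0, ?_⟩ (congruenceEigenspace_conj hv h)
  rw [zero_smul, add_zero, ← Matrix.smul_mul, mem_commutantMod.1 hh, Matrix.smul_mul, mul_assoc,
    map_mul_map_inv, mul_one]

/-- The commutator of two elements that are polynomials in `A` modulo `p` lies in the congruence
kernel, and there the character of `A` is trivial on it. -/
theorem apply_comm_of_mem_adjoin (hp : p * p = 0) (hv : v ∈ congruenceEigenspace μ p ψ ρ A)
    {g h : Γ} {C D X Y : Matrix n n R} (hC : C ∈ Algebra.adjoin R {A})
    (hD : D ∈ Algebra.adjoin R {A}) (hg : μ g = C + p • X) (hh : μ h = D + p • Y) :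
    ρ g (ρ h v) = ρ h (ρ g v) := by
  have hgA : μ g ∈ commutantMod p A := mem_commutantMod_of_eq_add_smul hp hC hg
  have hhA : μ h ∈ commutantMod p A := mem_commutantMod_of_eq_add_smul hp hD hh
  have hcomm : C * D = D * C :=
    Algebra.commute_of_mem_adjoin_singleton_of_commute hD
      (Algebra.commute_of_mem_adjoin_self hC).symm
  set M := μ (h * g)⁻¹
  have hMA : M * A ∈ commutantMod p A := mul_mem (mem_commutantMod_of_mul_eq_one
    (map_mul μ h g ▸ mul_mem hhA hgA) (map_mul_map_inv μ _) (map_inv_mul_map μ _))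
    (mem_commutantMod.2 rfl)
  let N := C * Y - Y * C + (X * D - D * X)
  have hcommutator : μ (g * h * (h * g)⁻¹) = 1 + p • (N * M) := by
    have hgh : μ (g * h) = μ (h * g) + p • N := by
      rw [map_mul, map_mul, hg, hh]
      simp only [N, add_mul, mul_add, smul_add, Matrix.smul_mul, Matrix.mul_smul, smul_smul, hp,
        zero_smul, smul_sub, hcomm]
      abel
    rw [map_mul, hgh, add_mul, map_mul_map_inv, Matrix.smul_mul]
  have hdet : (μ (g * h * (h * g)⁻¹)).det = 1 := by
    rw [map_mul, map_mul, Matrix.det_mul, Matrix.det_mul, mul_comm (μ g).det, ← Matrix.det_mul,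
      ← map_mul, ← Matrix.det_mul, map_mul_map_inv, Matrix.det_one]
  have htrace : p * (A * (N * M)).trace = 0 := by
    have hCY := mul_trace_mul_comm_sub_eq_zero (adjoin_le_commutantMod hMA hC) Y
    have hDX := mul_trace_mul_comm_sub_eq_zero (adjoin_le_commutantMod hMA hD) X
    rw [← mul_assoc, Matrix.trace_mul_comm, ← mul_assoc, show N = C * Y - Y * C - (D * X - X * D)
      from (congrArg _ (neg_sub _ _).symm).trans (sub_eq_add_neg _ _).symm, mul_sub (M * A),
      Matrix.trace_sub, mul_sub, hCY, hDX, sub_zero]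
  have hfix := apply_mem_congruenceEigenspace hp hhA (apply_mem_congruenceEigenspace hp hgA hv)
    _ _ hdet hcommutator
  rw [htrace, AddChar.map_zero_eq_one, one_smul] at hfix
  rw [← End.mul_apply, ← map_mul, ← inv_mul_cancel_right (g * h) (h * g), map_mul, map_mul ρ h,
    End.mul_apply, End.mul_apply, hfix]

theorem disjoint_congruenceEigenspace_iSup (hp : p * p = 0) (hψ : ψ.IsPrimitive)
    (hμ : ∀ M : Matrix n n R, M.det = 1 → ∃ γ, μ γ = M) (hμ_inj : Function.Injective μ)
    {ι : Type*} {a : ι → Matrix n n R} (ha : ∀ i, ¬ CongrModScalar p (a i) A) :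
    Disjoint (congruenceEigenspace μ p ψ ρ A) (⨆ i, congruenceEigenspace μ p ψ ρ (a i)) := by
  let K := {x : Γ × Matrix n n R // (μ x.1).det = 1 ∧ μ x.1 = 1 + p • x.2}
  let T : K → End 𝕜 V := fun x => ρ x.1.1
  let χ : Matrix n n R → K → 𝕜 := fun A x => ψ (p * (A * x.1.2).trace)
  have hcomm (x y : K) : Commute (T x) (T y) := by
    have hxy : x.1.1 * y.1.1 = y.1.1 * x.1.1 := hμ_inj <| by
      rw [map_mul, map_mul, x.2.2, y.2.2]
      simp only [add_mul, mul_add, Matrix.smul_mul, Matrix.mul_smul, smul_smul, hp, zero_smul,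
        one_mul, mul_one]
      abel
    exact (map_mul ρ _ _).symm.trans ((congrArg ρ hxy).trans (map_mul ρ _ _))
  have hle (A : Matrix n n R) :
      congruenceEigenspace μ p ψ ρ A ≤ ⨅ x, (T x).maxGenEigenspace (χ A x) := fun v hv =>
    (Submodule.mem_iInf _).2 fun x => End.mem_maxGenEigenspace _ _ _ |>.2
      ⟨1, by rw [pow_one]; exact sub_eq_zero.2 (hv _ _ x.2.1 x.2.2)⟩
  have hne (i : ι) : χ (a i) ≠ χ A := fun h => ha i <| congrModScalar_of_addChar hψ fun B hB => by
    have hdet : (1 + p • B).det = 1 := by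
      rw [det_one_add_smul_of_mul_self_eq_zero hp, hB, mul_zero, add_zero]
    obtain ⟨γ, hγ⟩ := hμ _ hdet
    have hAi : ψ (p * (a i * B).trace) = ψ (p * (A * B).trace) :=
      congrFun h ⟨(γ, B), hγ ▸ hdet, hγ⟩
    rw [sub_mul, Matrix.trace_sub, mul_sub, AddChar.map_sub_eq_div, hAi,
      div_self (ψ.val_isUnit _).ne_zero]
  exact (End.independent_iInf_maxGenEigenspace_of_forall_mapsTo T
    (fun i j c => End.mapsTo_maxGenEigenspace_of_comm (hcomm j i) c) (χ A)).mono (hle A)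
    (iSup_le fun i => le_iSup₂_of_le (χ (a i)) (hne i) (hle _))

theorem congrModScalar_of_mem_congruenceEigenspace (hp : p * p = 0) (hψ : ψ.IsPrimitive)
    (hμ : ∀ M : Matrix n n R, M.det = 1 → ∃ γ, μ γ = M) (hμ_inj : Function.Injective μ)
    (h0 : v ≠ 0) (hv : v ∈ congruenceEigenspace μ p ψ ρ A)
    (hv' : v ∈ congruenceEigenspace μ p ψ ρ A') : CongrModScalar p A A' := by
  by_contra h
  exact h0 <| Submodule.disjoint_def.1 (disjoint_congruenceEigenspace_iSup (ι := Unit)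
    hp hψ hμ hμ_inj fun _ => h) v hv' (Submodule.mem_iSup_of_mem () hv)

theorem exists_congrModScalar_conj [ρ.IsIrreducible] (hp : p * p = 0) (hψ : ψ.IsPrimitive)
    (hμ : ∀ M : Matrix n n R, M.det = 1 → ∃ γ, μ γ = M) (hμ_inj : Function.Injective μ)
    (hv0 : v ≠ 0) (hv : v ∈ congruenceEigenspace μ p ψ ρ A) {v' : V} (hv0' : v' ≠ 0)
    (hv' : v' ∈ congruenceEigenspace μ p ψ ρ A') :
    ∃ g, CongrModScalar p (μ g * A * μ g⁻¹) A' := by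
  by_contra! h
  have htop : (cyclicSub ρ v).toSubmodule ≤
      ⨆ g, congruenceEigenspace μ p ψ ρ (μ g * A * μ g⁻¹) := by
    refine Submodule.span_le.2 ?_
    rintro _ ⟨g, rfl⟩
    exact Submodule.mem_iSup_of_mem g (congruenceEigenspace_conj hv g)
  rw [cyclicSub_eq_top ρ hv0] at htop
  exact hv0' <| Submodule.disjoint_def.1 (disjoint_congruenceEigenspace_iSup hp hψ hμ hμ_inj h)
    v' hv' (htop Submodule.mem_top)

theorem congrModScalar_conj_inv_mul {g h : Γ}
    (H : CongrModScalar p (μ g * A * μ g⁻¹) (μ h * A * μ h⁻¹)) :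
    CongrModScalar p (μ (h⁻¹ * g) * A * μ (h⁻¹ * g)⁻¹) A := by
  convert H.conj (map_inv_mul_map μ h) using 1
  · rw [mul_inv_rev, inv_inv, map_mul, map_mul]
    simp only [mul_assoc]
  · rw [← mul_assoc, ← mul_assoc, map_inv_mul_map, one_mul, mul_assoc, map_inv_mul_map, mul_one]

theorem index_mul_finrank_congruenceEigenspace_le [FiniteDimensional 𝕜 V] (hp : p * p = 0)
    (hψ : ψ.IsPrimitive) (hμ : ∀ M : Matrix n n R, M.det = 1 → ∃ γ, μ γ = M)
    (hμ_inj : Function.Injective μ) {D : Subgroup Γ} [D.FiniteIndex]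
    (hD : ∀ g, CongrModScalar p (μ g * A * μ g⁻¹) A → g ∈ D) :
    D.index * finrank 𝕜 (congruenceEigenspace μ p ψ ρ A) ≤ finrank 𝕜 V := by
  classical
  let E (x : Γ ⧸ D) := congruenceEigenspace μ p ψ ρ (μ x.out * A * μ x.out⁻¹)
  have hE : iSupIndep E := fun x => by
    rw [iSup_subtype']
    refine disjoint_congruenceEigenspace_iSup hp hψ hμ hμ_inj fun y hxy => y.2 ?_
    have hmem := hD _ (congrModScalar_conj_inv_mul hxy)
    rw [← QuotientGroup.eq] at hmem
    exact (y.1.out_eq'.symm.trans hmem.symm).trans x.out_eq'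
  have hrank (x : Γ ⧸ D) : finrank 𝕜 (congruenceEigenspace μ p ψ ρ A) ≤ finrank 𝕜 (E x) :=
    LinearMap.finrank_le_finrank_of_injective
      (f := (ρ x.out).restrict fun v hv => congruenceEigenspace_conj hv x.out)
      fun v w h => Subtype.ext ((ρ.apply_bijective x.out).1 (congrArg Subtype.val h))
  have : Fintype (Γ ⧸ D) := Fintype.ofFinite _
  calc D.index * finrank 𝕜 (congruenceEigenspace μ p ψ ρ A)
      = ∑ _x : Γ ⧸ D, finrank 𝕜 (congruenceEigenspace μ p ψ ρ A) := by
        rw [Finset.sum_const, Finset.card_univ, ← Nat.card_eq_fintype_card, smul_eq_mul,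
          Subgroup.index]
    _ ≤ ∑ x, finrank 𝕜 (E x) := Finset.sum_le_sum fun x _ => hrank x
    _ = finrank 𝕜 (DirectSum (Γ ⧸ D) fun x => E x) := (finrank_directSum 𝕜 _).symm
    _ ≤ finrank 𝕜 V := LinearMap.finrank_le_finrank_of_injective hE.dfinsupp_lsum_injective

theorem congruenceEigenspace_le_mul (c : R) :
    congruenceEigenspace μ p ψ ρ A ≤ congruenceEigenspace μ (p * c) ψ ρ A := by
  intro v hv γ B hdet hγ
  rw [hv γ (c • B) hdet (by rw [hγ, mul_smul]), Matrix.mul_smul, Matrix.trace_smul, smul_eq_mul,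
    mul_assoc]

theorem apply_eq_one_of_congrModScalar_zero [ρ.IsIrreducible] (hp : p * p = 0) (h0 : v ≠ 0)
    (hv : v ∈ congruenceEigenspace μ p ψ ρ A) (hA : CongrModScalar p A 0) {γ : Γ}
    {B : Matrix n n R} (hdet : (μ γ).det = 1) (hγ : μ γ = 1 + p • B) : ρ γ = 1 := by
  have htop : (cyclicSub ρ v).toSubmodule ≤ congruenceEigenspace μ p ψ ρ 0 := by
    refine Submodule.span_le.2 ?_
    rintro _ ⟨g, rfl⟩
    have hg := congruenceEigenspace_conj (congruenceEigenspace_congr hp hA hv) g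
    rwa [mul_zero, zero_mul] at hg
  rw [cyclicSub_eq_top ρ h0] at htop
  refine LinearMap.ext fun w => (htop Submodule.mem_top γ B hdet hγ).trans ?_
  rw [zero_mul, Matrix.trace_zero, mul_zero, AddChar.map_zero_eq_one, one_smul, End.one_apply]

theorem congrModScalar_conj_of_smul_eq_one (hp : p * p = 0) (hψ : ψ.IsPrimitive)
    (hμ : ∀ M : Matrix n n R, M.det = 1 → ∃ γ, μ γ = M) (hμ_inj : Function.Injective μ)
    (h0 : v ≠ 0) (hv : v ∈ congruenceEigenspace μ p ψ ρ A) {χ : Γ → 𝕜}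
    (hχ : ∀ γ B, (μ γ).det = 1 → μ γ = 1 + p • B → χ γ • ρ γ = 1) (g : Γ) :
    CongrModScalar p (μ g * A * μ g⁻¹) A := by
  have hg0 : ρ g v ≠ 0 := (map_ne_zero_iff _ (ρ.apply_bijective g).1).2 h0
  refine congrModScalar_of_mem_congruenceEigenspace hp hψ hμ hμ_inj hg0
    (congruenceEigenspace_conj hv g) fun γ B hdet hγ => ?_
  have hscalar (w : V) : χ γ • ρ γ w = w := LinearMap.congr_fun (hχ γ B hdet hγ) w
  have hχγ : χ γ ≠ 0 := fun h => h0 <| by rw [← hscalar v, h, zero_smul]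
  refine smul_right_injective V hχγ ((hscalar _).trans ?_)
  change ρ g v = χ γ • ψ (p * (A * B).trace) • ρ g v
  rw [← map_smul, ← map_smul, ← hv γ B hdet hγ, hscalar]

end CongruenceEigenspace

/-! ### Matrices diagonal modulo `p` -/

/-- The annihilator of `p` is the ideal generated by `p`, as for `π ^ ℓ` in `𝔬_{2ℓ}`. -/
def IsSelfAnnihilating {R : Type*} [CommRing R] (p : R) : Prop :=
  ∀ y, p * y = 0 ↔ p ∣ y

section DiagSubgroup

variable {R : Type*} [CommRing R] {p : R}

theorem IsSelfAnnihilating.mul_self (hp : IsSelfAnnihilating p) : p * p = 0 :=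
  (hp p).2 dvd_rfl

theorem IsSelfAnnihilating.dvd_of_isUnit (hp : IsSelfAnnihilating p) {u w : R} (hu : IsUnit u)
    (h : p * (u * w) = 0) : p ∣ w :=
  (hu.dvd_mul_left).1 ((hp _).1 h)

/-- The subgroup of `SL(2, R)` of the matrices that are diagonal modulo `p`. -/
def diagSubgroup (p : R) : Subgroup SL(2, R) where
  carrier := {g | p ∣ g 0 1 ∧ p ∣ g 1 0}
  one_mem' := ⟨dvd_zero p, dvd_zero p⟩
  mul_mem' {g h} hg hh := by
    simp only [Set.mem_ofPred_eq, Matrix.SpecialLinearGroup.coe_mul, Matrix.mul_apply,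
      Fin.sum_univ_two] at *
    exact ⟨dvd_add (hh.1.mul_left _) (hg.1.mul_right _),
      dvd_add (hg.2.mul_right _) (hh.2.mul_left _)⟩
  inv_mem' {g} hg := by
    rw [Matrix.SpecialLinearGroup.SL2_inv_expl]
    exact ⟨(dvd_neg.2 hg.1 : p ∣ -(g 0 1)), (dvd_neg.2 hg.2 : p ∣ -(g 1 0))⟩

theorem mem_diagSubgroup {g : SL(2, R)} : g ∈ diagSubgroup p ↔ p ∣ g 0 1 ∧ p ∣ g 1 0 := Iff.rfl

theorem mem_diagSubgroup_of_eq_one_add_smul {g : SL(2, R)} {B : Matrix (Fin 2) (Fin 2) R}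
    (h : (g : Matrix (Fin 2) (Fin 2) R) = 1 + p • B) : g ∈ diagSubgroup p := by
  rw [mem_diagSubgroup, h]
  exact ⟨⟨B 0 1, by simp⟩, ⟨B 1 0, by simp⟩⟩

theorem mul_apply_of_mem_diagSubgroup (hp : p * p = 0) {g : SL(2, R)} (hg : g ∈ diagSubgroup p) :
    g 0 0 * g 1 1 = 1 := by
  obtain ⟨⟨x, hx⟩, y, hy⟩ := hg
  have hdet := g.det_coe
  rw [Matrix.det_fin_two, hx, hy] at hdet
  linear_combination hdet + x * y * hp

/-- The upper left entry of a matrix which is diagonal modulo `p`, as a homomorphism to the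
units. -/
def diagUnit (hp : p * p = 0) : diagSubgroup p →* Rˣ where
  toFun g := .mkOfMulEqOne (g.1 0 0) (g.1 1 1) (mul_apply_of_mem_diagSubgroup hp g.2)
  map_one' := Units.ext rfl
  map_mul' g h := by
    ext
    obtain ⟨x, hx⟩ := g.2.1
    obtain ⟨y, hy⟩ := h.2.2
    simp only [Subgroup.coe_mul, Matrix.SpecialLinearGroup.coe_mul, Matrix.mul_apply,
      Fin.sum_univ_two, Units.val_mul, Units.val_mkOfMulEqOne]
    rw [hx, hy]
    linear_combination x * y * hp

theorem val_diagUnit (hp : p * p = 0) (g : diagSubgroup p) : (diagUnit hp g : R) = g.1 0 0 := rfl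

/-- The character `g ↦ τ (g₀₀)` of the group of matrices that are diagonal modulo `p`. -/
def diagCharacter {𝕜 : Type*} [Field 𝕜] (hp : p * p = 0) (τ : Rˣ →* 𝕜ˣ) : diagSubgroup p →* 𝕜 :=
  (Units.coeHom 𝕜).comp (τ.comp (diagUnit hp))

theorem diagCharacter_apply {𝕜 : Type*} [Field 𝕜] (hp : p * p = 0) (τ : Rˣ →* 𝕜ˣ)
    (g : diagSubgroup p) : diagCharacter hp τ g = τ (diagUnit hp g) := rfl

/-- The diagonal torus `u ↦ diag(u, u⁻¹)` of `SL(2, R)`. -/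
def torus : Rˣ →* SL(2, R) where
  toFun u := ⟨!![(u : R), 0; 0, (u⁻¹ : Rˣ)], by simp [Matrix.det_fin_two]⟩
  map_one' := by ext i j; fin_cases i <;> fin_cases j <;> simp
  map_mul' u v := Subtype.ext <| by
    change !![((u * v : Rˣ) : R), 0; 0, ((u * v)⁻¹ : Rˣ)] =
      !![(u : R), 0; 0, (u⁻¹ : Rˣ)] * !![(v : R), 0; 0, (v⁻¹ : Rˣ)]
    simp [mul_comm]

theorem coe_torus (u : Rˣ) :
    (torus u : Matrix (Fin 2) (Fin 2) R) = !![(u : R), 0; 0, (u⁻¹ : Rˣ)] := rfl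

theorem torus_mem_diagSubgroup (u : Rˣ) : torus u ∈ diagSubgroup p := ⟨dvd_zero p, dvd_zero p⟩

theorem diagUnit_torus (hp : p * p = 0) (u : Rˣ) :
    diagUnit hp ⟨torus u, torus_mem_diagSubgroup u⟩ = u := Units.ext rfl

theorem torus_inv_mul_eq (hp : p * p = 0) (g : diagSubgroup p) :
    ∃ x y, coeMonoidHom ((torus (diagUnit hp g))⁻¹ * g.1) = 1 + p • !![0, x; y, 0] := by
  set u := diagUnit hp g with hu
  have hu11 : (u : R) * g.1 1 1 = 1 := u.mul_inv
  obtain ⟨x, hx⟩ := g.2.1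
  obtain ⟨y, hy⟩ := g.2.2
  refine ⟨(u⁻¹ : Rˣ) * x, u * y, ?_⟩
  rw [← map_inv, map_mul, Matrix.SpecialLinearGroup.coeMonoidHom_apply, coe_torus, inv_inv]
  ext i j
  fin_cases i <;> fin_cases j <;> simp [Matrix.mul_apply, Fin.sum_univ_two, hx, hy, hu11,
    mul_left_comm, ← val_diagUnit hp g, ← hu]

variable (R) in
/-- The nontrivial Weyl element of `SL(2, R)`, exchanging the two diagonal entries. -/
def weyl : SL(2, R) := ⟨!![0, 1; -1, 0], by simp [Matrix.det_fin_two]⟩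

theorem coe_weyl_inv : ((weyl R)⁻¹ : SL(2, R)).1 = !![0, -1; 1, 0] := by
  rw [Matrix.SpecialLinearGroup.SL2_inv_expl]
  ext i j
  fin_cases i <;> fin_cases j <;> simp [weyl]

theorem mul_weyl_inv_mem_diagSubgroup {g : SL(2, R)} (h0 : p ∣ g 0 0) (h1 : p ∣ g 1 1) :
    g * (weyl R)⁻¹ ∈ diagSubgroup p := by
  rw [mem_diagSubgroup, Matrix.SpecialLinearGroup.coe_mul, coe_weyl_inv]
  simpa [Matrix.mul_apply, Fin.sum_univ_two] using ⟨h0, h1⟩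

theorem coe_weyl_inv_mul_mul_weyl (g : SL(2, R)) :
    ((weyl R)⁻¹ * g * weyl R : SL(2, R)).1 = !![g 1 1, -g 1 0; -g 0 1, g 0 0] := by
  rw [Matrix.SpecialLinearGroup.coe_mul, Matrix.SpecialLinearGroup.coe_mul, coe_weyl_inv,
    Matrix.eta_fin_two (g : Matrix (Fin 2) (Fin 2) R)]
  ext i j
  fin_cases i <;> fin_cases j <;> simp [weyl, Matrix.mul_apply, Fin.sum_univ_two]

theorem weyl_inv_mul_mul_weyl_mem (g : diagSubgroup p) :
    (weyl R)⁻¹ * g * weyl R ∈ diagSubgroup p := by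
  rw [mem_diagSubgroup, coe_weyl_inv_mul_mul_weyl]
  exact ⟨dvd_neg.2 g.2.2, dvd_neg.2 g.2.1⟩

theorem diagUnit_weyl_inv_mul_mul_weyl (hp : p * p = 0) (g : diagSubgroup p) :
    diagUnit hp ⟨(weyl R)⁻¹ * g * weyl R, weyl_inv_mul_mul_weyl_mem g⟩ = (diagUnit hp g)⁻¹ := by
  ext
  rw [val_diagUnit, coe_weyl_inv_mul_mul_weyl]
  rfl

theorem exists_mul_entries_of_congrModScalar_conj {g : SL(2, R)} {a b a' b' : R}
    (h : CongrModScalar p (coeMonoidHom g * !![a', 0; 0, b'] * coeMonoidHom g⁻¹) !![a, 0; 0, b]) :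
    ∃ x, p * (g 0 0 * (a' - a - x)) = 0 ∧ p * (g 0 1 * (b' - a - x)) = 0 ∧
      p * (g 1 0 * (a' - b - x)) = 0 ∧ p * (g 1 1 * (b' - b - x)) = 0 := by
  obtain ⟨x, hx⟩ := h
  have hx' : p • (coeMonoidHom g * !![a', 0; 0, b']) =
      p • ((!![a, 0; 0, b] + x • (1 : Matrix (Fin 2) (Fin 2) R)) * coeMonoidHom g) := by
    rw [← Matrix.smul_mul p _ (coeMonoidHom g), ← hx, Matrix.smul_mul, mul_assoc, map_inv_mul_map,
      mul_one]
  have h00 := congrFun (congrFun hx' 0) 0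
  have h01 := congrFun (congrFun hx' 0) 1
  have h10 := congrFun (congrFun hx' 1) 0
  have h11 := congrFun (congrFun hx' 1) 1
  simp only [Matrix.SpecialLinearGroup.coeMonoidHom_apply, Matrix.smul_apply, Matrix.add_apply,
    Matrix.mul_apply, Fin.sum_univ_two, Matrix.of_apply, Matrix.cons_val', Matrix.cons_val_zero,
    Matrix.cons_val_one, Matrix.cons_val_fin_one, Matrix.one_apply_eq, Matrix.one_apply_ne,
    ne_eq, zero_ne_one, one_ne_zero, not_false_eq_true, smul_eq_mul, mul_zero, zero_mul, mul_one,
    add_zero, zero_add] at h00 h01 h10 h11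
  exact ⟨x, by linear_combination h00, by linear_combination h01, by linear_combination h10,
    by linear_combination h11⟩

variable [IsLocalRing R]

theorem mem_diagSubgroup_or_of_congrModScalar_conj (hp : IsSelfAnnihilating p) {g : SL(2, R)}
    {a b a' b' : R} (hab : IsUnit (a - b)) (hab' : IsUnit (a' - b'))
    (h : CongrModScalar p (coeMonoidHom g * !![a', 0; 0, b'] * coeMonoidHom g⁻¹) !![a, 0; 0, b]) :
    g ∈ diagSubgroup p ∨ p ∣ g 0 0 ∧ p ∣ g 1 1 ∧ p * (a + a' - b - b') = 0 := by
  obtain ⟨x, h00, h01, h10, h11⟩ := exists_mul_entries_of_congrModScalar_conj h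
  have cancel {u y : R} (hu : IsUnit u) (h : p * (u * y) = 0) : p * y = 0 :=
    (hp _).2 (hp.dvd_of_isUnit hu h)
  have hdet : g 0 0 * g 1 1 + -(g 0 1 * g 1 0) = 1 := by
    rw [← sub_eq_add_neg, ← Matrix.det_fin_two, g.det_coe]
  rcases IsLocalRing.isUnit_or_isUnit_of_add_one hdet with hu | hu
  · have e := cancel (isUnit_of_mul_isUnit_left hu) h00
    exact .inl ⟨hp.dvd_of_isUnit hab' (by linear_combination g 0 1 * e - h01),
      hp.dvd_of_isUnit hab (by linear_combination h10 - g 1 0 * e)⟩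
  · rw [IsUnit.neg_iff] at hu
    have e01 := cancel (isUnit_of_mul_isUnit_left hu) h01
    have e10 := cancel (isUnit_of_mul_isUnit_right hu) h10
    exact .inr ⟨hp.dvd_of_isUnit hab' (by linear_combination h00 - g 0 0 * e01),
      hp.dvd_of_isUnit hab (by linear_combination h11 - g 1 1 * e01),
      by linear_combination e10 - e01⟩

theorem mem_diagSubgroup_of_congrModScalar_conj (hp : IsSelfAnnihilating p) (h2 : ¬ p ∣ 2)
    {g : SL(2, R)} {a b : R} (hab : IsUnit (a - b))
    (h : CongrModScalar p (coeMonoidHom g * !![a, 0; 0, b] * coeMonoidHom g⁻¹) !![a, 0; 0, b]) :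
    g ∈ diagSubgroup p := by
  refine (mem_diagSubgroup_or_of_congrModScalar_conj hp hab hab h).resolve_right fun hanti => ?_
  exact h2 (hp.dvd_of_isUnit hab (by linear_combination hanti.2.2))

end DiagSubgroup

/-! ### Characters of the units -/

section UnitCharacters

variable {R : Type*} [CommRing R] {p s : R}

/-- `s` generates the smallest nonzero ideal, as `π ^ (2ℓ - 1)` does in `𝔬_{2ℓ}`. -/
def IsSocleGenerator (s : R) : Prop :=
  s ≠ 0 ∧ ∀ t ≠ 0, t ∣ s

theorem IsSocleGenerator.mul_eq_zero [IsLocalRing R] (hs : IsSocleGenerator s) {x : R}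
    (hx : ¬ IsUnit x) : s * x = 0 := by
  by_contra h
  obtain ⟨y, hy⟩ := hs.2 _ h
  have hunit : IsUnit (1 - x * y) :=
    (IsLocalRing.isUnit_or_isUnit_of_add_one (add_sub_cancel (x * y) 1)).resolve_left
      fun hu => hx (isUnit_of_mul_isUnit_left hu)
  exact hs.1 (hunit.mul_left_eq_zero.1 (by linear_combination hy))

theorem IsSocleGenerator.isPrimitive {𝕜 : Type*} [CommMonoid 𝕜] {ψ : AddChar R 𝕜}
    (hs : IsSocleGenerator s) (hψ : ψ s ≠ 1) : ψ.IsPrimitive := by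
  intro t ht h
  obtain ⟨x, hx⟩ := hs.2 t ht
  exact hψ (hx ▸ DFunLike.congr_fun h x)

theorem IsSelfAnnihilating.dvd_of_isSocleGenerator (hp : IsSelfAnnihilating p)
    (hs : IsSocleGenerator s) : p ∣ s := by
  refine hs.2 p ?_
  rintro rfl
  have h1 : (1 : R) = 0 := zero_dvd_iff.1 ((hp 1).1 (zero_mul 1))
  exact hs.1 (by rw [← mul_one s, h1, mul_zero])

theorem exists_eq_apply_mul [Finite R] {ψ : AddChar R ℂ} (hψ : ψ.IsPrimitive)
    (χ : AddChar R ℂ) : ∃ t, ∀ y, χ y = ψ (t * y) := by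
  classical
  have : Fintype R := Fintype.ofFinite R
  have hbij := (Fintype.bijective_iff_injective_and_card _).2
    ⟨AddChar.to_mulShift_inj_of_isPrimitive hψ, AddChar.card_eq.symm⟩
  obtain ⟨t, ht⟩ := hbij.2 χ
  exact ⟨t, fun y => DFunLike.congr_fun ht.symm y⟩

theorem exists_eq_apply_mul_mul [Finite R] {ψ : AddChar R ℂ} (hψ : ψ.IsPrimitive)
    (hp : IsSelfAnnihilating p) (χ : AddChar R ℂ) (hχ : ∀ y, χ (p * y) = 1) :
    ∃ t, ∀ y, χ y = ψ (p * (t * y)) := by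
  obtain ⟨t, ht⟩ := exists_eq_apply_mul hψ χ
  have h0 : p * t = 0 := of_not_not fun h => hψ h <| DFunLike.ext _ _ fun x => by
    rw [AddChar.mulShift_apply, mul_comm p, mul_assoc, ← ht, hχ, AddChar.one_apply]
  obtain ⟨t', rfl⟩ := (hp t).1 h0
  exact ⟨t', fun y => by rw [ht, mul_assoc]⟩

/-- The homomorphism `y ↦ 1 + p y` to the units, for `p` of square zero. -/
def oneAddMul (hp : p * p = 0) : Multiplicative R →* Rˣ where
  toFun y := .mkOfMulEqOne (1 + p * y.toAdd) (1 - p * y.toAdd)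
    (by linear_combination -y.toAdd * y.toAdd * hp)
  map_one' := Units.ext (by simp)
  map_mul' x y := Units.ext <| by
    simp only [toAdd_mul, Units.val_mul, Units.val_mkOfMulEqOne]
    linear_combination -x.toAdd * y.toAdd * hp

theorem val_oneAddMul (hp : p * p = 0) (y : R) :
    (oneAddMul hp (.ofAdd y) : R) = 1 + p * y := rfl

theorem val_inv_oneAddMul (hp : p * p = 0) (y : R) :
    ((oneAddMul hp (.ofAdd y))⁻¹ : Rˣ) = 1 - p * y := rfl

/-- `τ` is nontrivial on the units congruent to one modulo `s`; for `s = π ^ (2ℓ - 1)` these are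
the characters of the units of `𝔬_{2ℓ}` of full conductor. -/
def IsPrimitiveUnitCharacter {M : Type*} [Monoid M] (s : R) (τ : Rˣ →* M) : Prop :=
  ∃ u : Rˣ, s ∣ (u : R) - 1 ∧ τ u ≠ 1

theorem exists_isUnit_apply_oneAddMul [IsLocalRing R] [Finite R] (hp : IsSelfAnnihilating p)
    (hs : IsSocleGenerator s) {ψ : AddChar R ℂ} (hψ : ψ.IsPrimitive) {τ : Rˣ →* ℂˣ}
    (hτ : IsPrimitiveUnitCharacter s τ) :
    ∃ t, IsUnit t ∧ ∀ y, (τ (oneAddMul hp.mul_self (.ofAdd y)) : ℂ) = ψ (p * (t * y)) := by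
  let χ : AddChar R ℂ := AddChar.toMonoidHomEquiv.symm
    ((Units.coeHom ℂ).comp (τ.comp (oneAddMul hp.mul_self)))
  have hχ (y : R) : χ y = τ (oneAddMul hp.mul_self (.ofAdd y)) := rfl
  obtain ⟨t, ht⟩ := exists_eq_apply_mul_mul hψ hp χ fun y => by
    have h1 : oneAddMul hp.mul_self (.ofAdd (p * y)) = 1 :=
      Units.ext (by rw [val_oneAddMul, ← mul_assoc, hp.mul_self, zero_mul, add_zero, Units.val_one])
    rw [hχ, h1, map_one, Units.val_one]
  refine ⟨t, of_not_not fun ht0 => ?_, fun y => by rw [← hχ, ht]⟩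
  obtain ⟨u, ⟨y, hy⟩, hu⟩ := hτ
  obtain ⟨c, hc⟩ := hp.dvd_of_isSocleGenerator hs
  have hu_eq : u = oneAddMul hp.mul_self (.ofAdd (c * y)) := Units.ext <| by
    rw [val_oneAddMul, ← mul_assoc, ← hc, ← hy, add_sub_cancel]
  have harg : p * (t * (c * y)) = 0 := by
    linear_combination y * hs.mul_eq_zero ht0 - t * y * hc
  exact hu (Units.ext (by rw [hu_eq, ← hχ, ht, harg, AddChar.map_zero_eq_one, Units.val_one]))

theorem ne_inv_of_isPrimitiveUnitCharacter [IsLocalRing R] [Finite R] (hp : IsSelfAnnihilating p)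
    (hs : IsSocleGenerator s) (h2 : ¬ p ∣ 2) {ψ : AddChar R ℂ} (hψ : ψ.IsPrimitive)
    {τ : Rˣ →* ℂˣ} (hτ : IsPrimitiveUnitCharacter s τ) : τ ≠ τ⁻¹ := by
  intro h
  obtain ⟨t, ht, hτt⟩ := exists_isUnit_apply_oneAddMul hp hs hψ hτ
  refine h2 (hp.dvd_of_isUnit ht (of_not_not fun h0 => hψ h0 (DFunLike.ext _ _ fun y => ?_)))
  have hsq := congrArg Units.val <| mul_eq_one_iff_eq_inv.2
    (DFunLike.congr_fun h (oneAddMul hp.mul_self (.ofAdd y)))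
  rw [Units.val_mul, hτt, ← AddChar.map_add_eq_mul, Units.val_one] at hsq
  rw [AddChar.mulShift_apply, AddChar.one_apply, ← hsq]
  exact congrArg ψ (by ring)

end UnitCharacters

/-! ### Representations above diagonal eigencharacters -/

section DiagonalWeights

open Module

variable {R 𝕜 V : Type*} [CommRing R] [Field 𝕜] [AddCommGroup V] [Module 𝕜 V] {p s : R}
  {ρ : Representation 𝕜 SL(2, R) V} {v : V} {ψ : AddChar R 𝕜}

theorem exists_coeMonoidHom_eq {n : Type*} [Fintype n] [DecidableEq n] (M : Matrix n n R)
    (h : M.det = 1) : ∃ γ : Matrix.SpecialLinearGroup n R, coeMonoidHom γ = M :=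
  ⟨⟨M, h⟩, rfl⟩

theorem mem_congruenceEigenspace_of_diagCharacter (hp : p * p = 0) {τ : Rˣ →* 𝕜ˣ}
    (hv : ∀ g : diagSubgroup p, ρ g v = diagCharacter hp τ g • v) {t : R}
    (ht : ∀ y, (τ (oneAddMul hp (.ofAdd y)) : 𝕜) = ψ (p * (t * y))) :
    v ∈ congruenceEigenspace coeMonoidHom p ψ ρ !![t, 0; 0, 0] := by
  intro γ B _ hγ
  have hu : diagUnit hp ⟨γ, mem_diagSubgroup_of_eq_one_add_smul hγ⟩ =
      oneAddMul hp (.ofAdd (B 0 0)) := Units.ext <| by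
    rw [val_diagUnit, val_oneAddMul, show γ 0 0 = _ from congrFun (congrFun hγ 0) 0]
    simp
  have htrace : (!![t, 0; 0, 0] * B).trace = t * B 0 0 := by
    rw [Matrix.eta_fin_two B]
    simp [Matrix.trace_fin_two]
  rw [hv ⟨γ, mem_diagSubgroup_of_eq_one_add_smul hγ⟩, diagCharacter_apply, hu, ht, htrace]

theorem apply_weyl_of_diagCharacter (hp : p * p = 0) {τ : Rˣ →* 𝕜ˣ}
    (hv : ∀ g : diagSubgroup p, ρ g v = diagCharacter hp τ g • v) (g : diagSubgroup p) :
    ρ g (ρ (weyl R) v) = diagCharacter hp τ⁻¹ g • ρ (weyl R) v := by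
  have hconj : ρ g (ρ (weyl R) v) = ρ (weyl R) (ρ ((weyl R)⁻¹ * g * weyl R) v) := by
    rw [← End.mul_apply, ← End.mul_apply, ← map_mul, ← map_mul, mul_assoc, mul_inv_cancel_left]
  rw [hconj, hv ⟨_, weyl_inv_mul_mul_weyl_mem g⟩, map_smul, diagCharacter_apply,
    diagCharacter_apply, diagUnit_weyl_inv_mul_mul_weyl, map_inv, MonoidHom.inv_apply]

theorem HasWeight.diagCharacter_inv (hp : p * p = 0) {τ : Rˣ →* 𝕜ˣ}
    (h : HasWeight ρ (diagCharacter hp τ)) : HasWeight ρ (diagCharacter hp τ⁻¹) := by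
  obtain ⟨v, hv0, hv⟩ := h
  exact ⟨ρ (weyl R) v, (map_ne_zero_iff _ (ρ.apply_bijective _).1).2 hv0,
    apply_weyl_of_diagCharacter hp hv⟩

theorem diagCharacter_injective (hp : p * p = 0) :
    Function.Injective (diagCharacter hp : (Rˣ →* 𝕜ˣ) → diagSubgroup p →* 𝕜) := by
  intro τ τ' h
  ext u
  have hu := DFunLike.congr_fun h ⟨torus u, torus_mem_diagSubgroup u⟩
  rwa [diagCharacter_apply, diagCharacter_apply, diagUnit_torus] at hu

theorem finrank_congruenceEigenspace_pos [FiniteDimensional 𝕜 V] {A : Matrix (Fin 2) (Fin 2) R}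
    (hv0 : v ≠ 0) (hv : v ∈ congruenceEigenspace coeMonoidHom p ψ ρ A) :
    0 < finrank 𝕜 (congruenceEigenspace coeMonoidHom p ψ ρ A) :=
  Module.finrank_pos_iff_exists_ne_zero.2 ⟨⟨v, hv⟩, fun h => hv0 (congrArg Subtype.val h)⟩

theorem exists_torus_eigenvector [IsAlgClosed 𝕜] [FiniteDimensional 𝕜 V] (hp : p * p = 0)
    (hv0 : v ≠ 0) {a b : R}
    (hv : v ∈ congruenceEigenspace coeMonoidHom p ψ ρ !![a, 0; 0, b]) :
    ∃ w ∈ congruenceEigenspace coeMonoidHom p ψ ρ !![a, 0; 0, b],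
      w ≠ 0 ∧ ∃ τ : Rˣ →* 𝕜ˣ, ∀ u, ρ (torus u) w = (τ u : 𝕜) • w := by
  have htorus (u : Rˣ) : coeMonoidHom (torus u) ∈ commutantMod p !![a, 0; 0, b] := by
    rw [mem_commutantMod, Matrix.SpecialLinearGroup.coeMonoidHom_apply, coe_torus]
    simp [mul_comm]
  obtain ⟨w, hwE, hw0, hw⟩ := exists_common_eigenvector_mem (fun u => ρ (torus u))
    ((Submodule.ne_bot_iff _).2 ⟨v, hv, hv0⟩)
    (fun u w => apply_mem_congruenceEigenspace hp (htorus u)) fun u u' w _ => by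
      rw [← End.mul_apply, ← End.mul_apply, ← map_mul, ← map_mul, ← map_mul, ← map_mul, mul_comm]
  obtain ⟨χ, hχ⟩ := exists_character (ρ.comp torus) hw0 hw
  exact ⟨w, hwE, hw0, χ.toHomUnits, hχ⟩

theorem isPrimitiveUnitCharacter_of_mem_congruenceEigenspace (hp : IsSelfAnnihilating p)
    (hs : IsSocleGenerator s) (hψ : ψ.IsPrimitive) {a b : R} (hab : IsUnit (a - b)) (hv0 : v ≠ 0)
    (hv : v ∈ congruenceEigenspace coeMonoidHom p ψ ρ !![a, 0; 0, b]) {τ : Rˣ →* 𝕜ˣ}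
    (hτ : ∀ u, ρ (torus u) v = (τ u : 𝕜) • v) : IsPrimitiveUnitCharacter s τ := by
  obtain ⟨c, hc⟩ := hp.dvd_of_isSocleGenerator hs
  obtain ⟨z, hz⟩ := hab.exists_right_inv
  by_contra! h
  refine hψ hs.1 (DFunLike.ext _ _ fun x => ?_)
  let u := oneAddMul hp.mul_self (.ofAdd (c * (z * x)))
  have hu : τ u = 1 := of_not_not fun hu => h ⟨u, ⟨z * x, by
    rw [val_oneAddMul, add_sub_cancel_left, hc, mul_assoc]⟩, hu⟩
  have hτu := hv (torus u) !![c * (z * x), 0; 0, -(c * (z * x))] (torus u).det_coe <| by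
    rw [Matrix.SpecialLinearGroup.coeMonoidHom_apply, coe_torus, val_oneAddMul, val_inv_oneAddMul]
    ext i j
    fin_cases i <;> fin_cases j <;> simp [sub_eq_add_neg]
  rw [hτ, hu] at hτu
  have htrace : (!![a, 0; 0, b] * !![c * (z * x), 0; 0, -(c * (z * x))]).trace =
      (a - b) * (c * (z * x)) := by
    simp [Matrix.trace_fin_two]
    ring
  rw [AddChar.mulShift_apply, AddChar.one_apply]
  refine Eq.trans (congrArg ψ ?_) (smul_left_injective 𝕜 hv0 hτu).symm
  rw [htrace]
  linear_combination x * hc - p * c * x * hz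

theorem exists_hasWeight_diagCharacter [IsAlgClosed 𝕜] [FiniteDimensional 𝕜 V]
    (hp : IsSelfAnnihilating p) (hs : IsSocleGenerator s)
    (hψ : ψ.IsPrimitive) {a b : R} (hab : IsUnit (a - b)) (hv0 : v ≠ 0)
    (hv : v ∈ congruenceEigenspace coeMonoidHom p ψ ρ !![a, 0; 0, b]) :
    ∃ τ : Rˣ →* 𝕜ˣ, IsPrimitiveUnitCharacter s τ ∧
      HasWeight ρ (diagCharacter hp.mul_self τ) := by
  obtain ⟨w, hwE, hw0, τ, hτ⟩ := exists_torus_eigenvector hp.mul_self hv0 hv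
  refine ⟨τ, isPrimitiveUnitCharacter_of_mem_congruenceEigenspace hp hs hψ hab hw0 hwE hτ,
    w, hw0, fun g => ?_⟩
  set u := diagUnit hp.mul_self g
  obtain ⟨x, y, hxy⟩ := torus_inv_mul_eq hp.mul_self g
  have hfix : ρ ((torus u)⁻¹ * g.1) w = w := by
    rw [hwE _ _ (Matrix.SpecialLinearGroup.det_coe _) hxy]
    simp [Matrix.trace_fin_two]
  calc ρ g w = ρ (torus u) (ρ ((torus u)⁻¹ * g.1) w) := by
        rw [← End.mul_apply, ← map_mul, mul_inv_cancel_left]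
    _ = diagCharacter hp.mul_self τ g • w := by rw [hfix, hτ, diagCharacter_apply]

variable [IsLocalRing R]

theorem index_diagSubgroup_mul_finrank_le [(diagSubgroup p).FiniteIndex] [FiniteDimensional 𝕜 V]
    (hp : IsSelfAnnihilating p) (h2 : ¬ p ∣ 2) (hψ : ψ.IsPrimitive) {a b : R}
    (hab : IsUnit (a - b)) : (diagSubgroup p).index *
      finrank 𝕜 (congruenceEigenspace coeMonoidHom p ψ ρ !![a, 0; 0, b]) ≤ finrank 𝕜 V :=
  index_mul_finrank_congruenceEigenspace_le hp.mul_self hψ exists_coeMonoidHom_eq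
    coeMonoidHom_injective fun _ => mem_diagSubgroup_of_congrModScalar_conj hp h2 hab

theorem finrank_eq_index_diagSubgroup [(diagSubgroup p).FiniteIndex] [FiniteDimensional 𝕜 V]
    [ρ.IsIrreducible] (hp : IsSelfAnnihilating p) (h2 : ¬ p ∣ 2) (hψ : ψ.IsPrimitive) {a b : R}
    (hab : IsUnit (a - b)) (hv0 : v ≠ 0)
    (hv : v ∈ congruenceEigenspace coeMonoidHom p ψ ρ !![a, 0; 0, b]) {χ : diagSubgroup p →* 𝕜}
    (hχ : HasWeight ρ χ) : finrank 𝕜 V = (diagSubgroup p).index := by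
  obtain ⟨w, hw0, hw⟩ := hχ
  exact (finrank_le_index ρ hw0 _ fun g hg => ⟨_, hw ⟨g, hg⟩⟩).antisymm <|
    (Nat.le_mul_of_pos_right _ (finrank_congruenceEigenspace_pos hv0 hv)).trans
      (index_diagSubgroup_mul_finrank_le hp h2 hψ hab)

theorem eq_of_hasWeight_diagCharacter_of_mem [(diagSubgroup p).FiniteIndex]
    [FiniteDimensional 𝕜 V] [ρ.IsIrreducible] (hp : IsSelfAnnihilating p) (h2 : ¬ p ∣ 2)
    (hψ : ψ.IsPrimitive) {a b : R} (hab : IsUnit (a - b)) {v v' : V} (hv0 : v ≠ 0) (hv0' : v' ≠ 0)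
    (hv : v ∈ congruenceEigenspace coeMonoidHom p ψ ρ !![a, 0; 0, b])
    (hv' : v' ∈ congruenceEigenspace coeMonoidHom p ψ ρ !![a, 0; 0, b])
    {χ χ' : diagSubgroup p →* 𝕜} (hχ : ∀ g : diagSubgroup p, ρ g v = χ g • v)
    (hχ' : ∀ g : diagSubgroup p, ρ g v' = χ' g • v') : χ = χ' := by
  have hle := index_diagSubgroup_mul_finrank_le (ρ := ρ) hp h2 hψ hab
  rw [finrank_eq_index_diagSubgroup hp h2 hψ hab hv0 hv ⟨v, hv0, hχ⟩] at hle
  have hrank := (Nat.le_of_mul_le_mul_left (hle.trans_eq (mul_one _).symm)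
    (Nat.pos_of_ne_zero Subgroup.FiniteIndex.index_ne_zero)).antisymm
    (finrank_congruenceEigenspace_pos hv0 hv)
  obtain ⟨c, hc⟩ := (finrank_eq_one_iff_of_nonzero' (⟨v, hv⟩ : congruenceEigenspace _ _ _ _ _)
    fun h => hv0 (congrArg Subtype.val h)).1 hrank ⟨v', hv'⟩
  have hcv : c • v = v' := congrArg Subtype.val hc
  refine DFunLike.ext _ _ fun g => smul_left_injective 𝕜 hv0' ?_
  change χ g • v' = χ' g • v'
  rw [← hχ', ← hcv, map_smul, hχ, smul_comm]

theorem eq_or_eq_inv_of_hasWeight_diagCharacter {V : Type*} [AddCommGroup V] [Module ℂ V]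
    [FiniteDimensional ℂ V] [Finite R] {ρ : Representation ℂ SL(2, R) V} [ρ.IsIrreducible]
    (hp : IsSelfAnnihilating p) (hs : IsSocleGenerator s) (h2 : ¬ p ∣ 2) {ψ : AddChar R ℂ}
    (hψ : ψ.IsPrimitive) {τ τ' : Rˣ →* ℂˣ} (hτ : IsPrimitiveUnitCharacter s τ)
    (hτ' : IsPrimitiveUnitCharacter s τ') (h : HasWeight ρ (diagCharacter hp.mul_self τ))
    (h' : HasWeight ρ (diagCharacter hp.mul_self τ')) : τ' = τ ∨ τ' = τ⁻¹ := by
  obtain ⟨v, hv0, hv⟩ := h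
  obtain ⟨v', hv0', hv'⟩ := h'
  obtain ⟨t, ht, hτt⟩ := exists_isUnit_apply_oneAddMul hp hs hψ hτ
  obtain ⟨t', ht', hτt'⟩ := exists_isUnit_apply_oneAddMul hp hs hψ hτ'
  rw [← sub_zero t] at ht
  rw [← sub_zero t'] at ht'
  have hvE := mem_congruenceEigenspace_of_diagCharacter hp.mul_self hv hτt
  have hvE' := mem_congruenceEigenspace_of_diagCharacter hp.mul_self hv' hτt'
  obtain ⟨g, hg⟩ := exists_congrModScalar_conj hp.mul_self hψ exists_coeMonoidHom_eq
    coeMonoidHom_injective hv0 hvE hv0' hvE'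
  have hgv := congruenceEigenspace_congr hp.mul_self hg (congruenceEigenspace_conj hvE g)
  have unique {w : V} {σ : Rˣ →* ℂˣ} (hw0 : w ≠ 0)
      (hw : ∀ g : diagSubgroup p, ρ g w = diagCharacter hp.mul_self σ g • w) {c : ℂ}
      (hc : ρ g v = c • w) : τ' = σ := by
    have hc0 : c ≠ 0 := fun h0 => (map_ne_zero_iff _ (ρ.apply_bijective g).1).2 hv0 <| by
      rw [hc, h0, zero_smul]
    rw [hc, Submodule.smul_mem_iff _ hc0] at hgv
    exact diagCharacter_injective hp.mul_self
      (eq_of_hasWeight_diagCharacter_of_mem hp h2 hψ ht' hv0' hw0 hvE' hgv hv' hw)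
  rcases mem_diagSubgroup_or_of_congrModScalar_conj hp ht' ht hg with hgD | ⟨h00, h11, -⟩
  · exact .inl (unique hv0 hv (hv ⟨g, hgD⟩))
  · have hweyl := apply_weyl_of_diagCharacter hp.mul_self hv
    refine .inr (unique ((map_ne_zero_iff _ (ρ.apply_bijective _).1).2 hv0) hweyl
      (c := diagCharacter hp.mul_self τ⁻¹ ⟨_, mul_weyl_inv_mem_diagSubgroup h00 h11⟩) ?_)
    rw [← hweyl, ← End.mul_apply, ← map_mul, inv_mul_cancel_right]

end DiagonalWeights

/-! ### Existence of eigencharacters -/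

section Existence

variable {R n : Type*} [CommRing R] [Fintype n] {p : R}

theorem exists_eq_apply_mul_trace_mul [Finite R] {ψ : AddChar R ℂ} (hψ : ψ.IsPrimitive)
    (hp : IsSelfAnnihilating p) (χ : AddChar (Matrix n n R) ℂ) (hχ : ∀ B, χ (p • B) = 1) :
    ∃ A : Matrix n n R, ∀ B, χ B = ψ (p * (A * B).trace) := by
  classical
  have hentry (i j : n) : ∃ t, ∀ y, χ (Matrix.single i j y) = ψ (p * (t * y)) :=
    exists_eq_apply_mul_mul hψ hp (χ.compAddMonoidHom (Matrix.singleAddMonoidHom i j)) fun y => by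
      rw [AddChar.compAddMonoidHom_apply, Matrix.singleAddMonoidHom_apply, ← smul_eq_mul,
        ← Matrix.smul_single, hχ]
  choose a ha using hentry
  let A : Matrix n n R := Matrix.of fun j i => a i j
  let χ' : AddChar (Matrix n n R) ℂ := ψ.compAddMonoidHom <|
    (AddMonoidHom.mulLeft p).comp ((Matrix.traceAddMonoidHom n R).comp (AddMonoidHom.mulLeft A))
  have h : χ.toAddMonoidHom = χ'.toAddMonoidHom := Matrix.ext_addMonoidHom fun i j =>
    AddMonoidHom.ext fun y => by
      have htrace : (A * Matrix.single i j y).trace = a i j * y := Matrix.trace_mul_single A i j y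
      refine (ha i j y).trans ?_
      rw [← htrace]
      rfl
  exact ⟨A, fun B => DFunLike.congr_fun h B⟩

variable [DecidableEq n]

/-- The homomorphism `B ↦ 1 + p (B - E)` to the special linear group, for `p` of square zero,
where subtracting the matrix `E` with single entry `tr B` at `(i, i)` normalizes the trace. -/
def congruenceHom (hp : p * p = 0) (i : n) :
    Multiplicative (Matrix n n R) →* Matrix.SpecialLinearGroup n R where
  toFun B := ⟨1 + p • (B.toAdd - Matrix.single i i B.toAdd.trace), by
    rw [det_one_add_smul_of_mul_self_eq_zero hp, Matrix.trace_sub, Matrix.trace_single_eq_same,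
      sub_self, mul_zero, add_zero]⟩
  map_one' := Subtype.ext (by simp)
  map_mul' X Y := Subtype.ext <| by
    have hmul (C D : Matrix n n R) : (1 + p • C) * (1 + p • D) = 1 + p • (C + D) := by
      rw [mul_add, mul_one, add_mul, one_mul, smul_mul_smul_comm, hp, zero_smul, add_zero,
        add_assoc, ← smul_add]
    refine (congrArg (fun C : Matrix n n R => 1 + p • C) ?_).trans (hmul _ _).symm
    rw [toAdd_mul, Matrix.trace_add, Matrix.single_add, add_sub_add_comm]

theorem eq_congruenceHom (hp : p * p = 0) (i : n) {γ : Matrix.SpecialLinearGroup n R}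
    {B : Matrix n n R} (hγ : coeMonoidHom γ = 1 + p • B) :
    γ = congruenceHom hp i (.ofAdd B) := by
  have htrace : p * B.trace = 0 := by
    have hdet := det_one_add_smul_of_mul_self_eq_zero hp B
    rwa [← hγ, Matrix.SpecialLinearGroup.coeMonoidHom_apply, γ.det_coe, left_eq_add] at hdet
  refine Subtype.ext (hγ.trans ?_)
  change _ = 1 + p • (B - Matrix.single i i B.trace)
  rw [smul_sub, Matrix.smul_single, smul_eq_mul, htrace, Matrix.single_zero, sub_zero]

theorem congruenceHom_smul (hp : p * p = 0) (i : n) (B : Matrix n n R) :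
    congruenceHom hp i (.ofAdd (p • B)) = 1 := by
  rw [← eq_congruenceHom hp i (γ := 1)]
  rw [map_one, smul_smul, hp, zero_smul, add_zero]

theorem exists_mem_congruenceEigenspace [Nonempty n] [Finite R] {V : Type*} [AddCommGroup V]
    [Module ℂ V] [FiniteDimensional ℂ V] [Nontrivial V] {ψ : AddChar R ℂ} (hψ : ψ.IsPrimitive)
    (hp : IsSelfAnnihilating p) (ρ : Representation ℂ (Matrix.SpecialLinearGroup n R) V) :
    ∃ A, ∃ v ≠ 0, v ∈ congruenceEigenspace coeMonoidHom p ψ ρ A := by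
  obtain ⟨i⟩ := ‹Nonempty n›
  let φ := congruenceHom hp.mul_self i
  obtain ⟨v, hv0, hv⟩ := exists_common_eigenvector (fun B => ρ (φ B)) fun B B' => by
    rw [← map_mul, ← map_mul, ← map_mul, ← map_mul, mul_comm]
  obtain ⟨χ, hχ⟩ := exists_character (ρ.comp φ) hv0 hv
  obtain ⟨A, hA⟩ := exists_eq_apply_mul_trace_mul hψ hp (AddChar.toMonoidHomEquiv.symm χ)
    fun B => smul_left_injective ℂ hv0 <| by
      change χ (.ofAdd (p • B)) • v = (1 : ℂ) • v
      rw [← hχ, MonoidHom.comp_apply, congruenceHom_smul, map_one, Module.End.one_apply, one_smul]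
  refine ⟨A, v, hv0, fun γ B _ hγ => ?_⟩
  rw [eq_congruenceHom hp.mul_self i hγ, ← hA]
  exact hχ (.ofAdd B)

end Existence

/-! ### Cyclic matrices -/

section Cyclic

open Matrix

variable {R R' : Type*} [CommRing R] [CommRing R'] {n : ℕ}

theorem isCyclicMatrix_iff_exists_isUnit {A : Matrix (Fin n) (Fin n) R} :
    IsCyclicMatrix A ↔
      ∃ v : Fin n → R, IsUnit (of fun i j : Fin n => ((A ^ (j : ℕ)) *ᵥ v) i) := by
  refine exists_congr fun v => ?_
  rw [← mulVec_surjective_iff_isUnit, ← coe_mulVecLin, ← LinearMap.range_eq_top, range_mulVecLin]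
  rfl

theorem IsCyclicMatrix.map {A : Matrix (Fin n) (Fin n) R} (hA : IsCyclicMatrix A)
    (f : R →+* R') : IsCyclicMatrix (A.map f) := by
  obtain ⟨v, hv⟩ := isCyclicMatrix_iff_exists_isUnit.1 hA
  refine isCyclicMatrix_iff_exists_isUnit.2 ⟨f ∘ v, ?_⟩
  convert hv.map f.mapMatrix using 1
  ext i j
  have hpow : A.map f ^ (j : ℕ) = (A ^ (j : ℕ)).map f := (map_pow f.mapMatrix A j).symm
  simp only [RingHom.mapMatrix_apply, map_apply, of_apply, f.map_mulVec, hpow]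

theorem IsCyclicMatrix.mem_adjoin_of_commute {A M : Matrix (Fin n) (Fin n) R}
    (hA : IsCyclicMatrix A) (h : Commute M A) : M ∈ Algebra.adjoin R {A} := by
  obtain ⟨v, hv⟩ := hA
  obtain ⟨c, hc⟩ := (Submodule.mem_span_range_iff_exists_fun R).1
    (hv.ge (Submodule.mem_top (x := M *ᵥ v)))
  set N := ∑ j : Fin n, c j • A ^ (j : ℕ) with hN
  have hNA : N ∈ Algebra.adjoin R {A} := Subalgebra.sum_mem _ fun j _ =>
    Subalgebra.smul_mem _ (pow_mem (Algebra.self_mem_adjoin_singleton R A) _) _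
  have hNv : M *ᵥ v = N *ᵥ v := by simp only [← hc, hN, sum_mulVec, smul_mulVec]
  have hNj : ∀ j : ℕ, Commute N (A ^ j) := fun j =>
    (Algebra.commute_of_mem_adjoin_self hNA).symm.pow_right j
  have : mulVecLin M = mulVecLin N := LinearMap.ext_on_range hv fun j => by
    simp only [mulVecLin_apply, mulVec_mulVec, (h.pow_right j).eq, (hNj j).eq]
    rw [← mulVec_mulVec, hNv, mulVec_mulVec]
  exact mulVec_injective (congrArg DFunLike.coe this) ▸ hNA

end Cyclic

section CyclicTwo

variable {R : Type*} [CommRing R] {A : Matrix (Fin 2) (Fin 2) R}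

theorem isCyclicMatrix_fin_two_iff : IsCyclicMatrix A ↔
    ∃ x y : R, IsUnit (A 1 0 * x ^ 2 - (A 0 0 - A 1 1) * (x * y) - A 0 1 * y ^ 2) := by
  have hdet (v : Fin 2 → R) :
      (Matrix.of fun i j : Fin 2 => ((A ^ (j : ℕ)) *ᵥ v) i).det =
        A 1 0 * v 0 ^ 2 - (A 0 0 - A 1 1) * (v 0 * v 1) - A 0 1 * v 1 ^ 2 := by
    simp only [Matrix.det_fin_two, Matrix.of_apply, Fin.val_zero, Fin.val_one, pow_zero, pow_one,
      Matrix.one_mulVec]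
    simp only [Matrix.mulVec, dotProduct, Fin.sum_univ_two]
    ring
  simp only [isCyclicMatrix_iff_exists_isUnit, Matrix.isUnit_iff_isUnit_det, hdet]
  exact ⟨fun ⟨v, hv⟩ => ⟨v 0, v 1, hv⟩, fun ⟨x, y, h⟩ => ⟨![x, y], h⟩⟩

theorem isCyclicMatrix_iff_isUnit_entries [IsLocalRing R] : IsCyclicMatrix A ↔
    IsUnit (A 0 1) ∨ IsUnit (A 1 0) ∨ IsUnit (A 0 0 - A 1 1) := by
  rw [isCyclicMatrix_fin_two_iff]
  refine ⟨fun ⟨x, y, h⟩ => ?_, ?_⟩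
  · by_contra! hA
    simp only [← mem_nonunits_iff, ← mem_maximalIdeal] at hA
    exact (mem_maximalIdeal _).1 (sub_mem (sub_mem (Ideal.mul_mem_right _ _ hA.2.1)
      (Ideal.mul_mem_right _ _ hA.2.2)) (Ideal.mul_mem_right _ _ hA.1)) h
  · intro h
    by_cases h01 : IsUnit (A 0 1)
    · exact ⟨0, 1, by simpa using h01⟩
    by_cases h10 : IsUnit (A 1 0)
    · exact ⟨1, 0, by simpa using h10⟩
    refine ⟨1, 1, ?_⟩
    have hdiag := (h.resolve_left h01).resolve_left h10
    by_contra hsum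
    simp only [← mem_nonunits_iff, ← mem_maximalIdeal] at h01 h10 hsum
    refine (mem_maximalIdeal _).1 ?_ hdiag
    convert sub_mem (sub_mem h10 hsum) h01 using 1
    ring

theorem not_isCyclicMatrix_algebraMap [Nontrivial R] (a : R) :
    ¬ IsCyclicMatrix (algebraMap R (Matrix (Fin 2) (Fin 2) R) a) := by
  rw [isCyclicMatrix_fin_two_iff]
  simp [Matrix.algebraMap_matrix_apply]

theorem IsCyclicMatrix.smul_one_add_smul_injective (hA : IsCyclicMatrix A) :
    Function.Injective fun x : R × R => x.1 • (1 : Matrix (Fin 2) (Fin 2) R) + x.2 • A := by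
  obtain ⟨v, hv⟩ := isCyclicMatrix_iff_exists_isUnit.1 hA
  have key (x : R × R) : (x.1 • (1 : Matrix (Fin 2) (Fin 2) R) + x.2 • A) *ᵥ v =
      (Matrix.of fun i j : Fin 2 => ((A ^ (j : ℕ)) *ᵥ v) i) *ᵥ ![x.1, x.2] := by
    ext i
    fin_cases i <;> simp [Matrix.mulVec, dotProduct, Fin.sum_univ_two] <;> ring
  intro x y hxy
  have h := Matrix.mulVec_injective_of_isUnit hv ((key x).symm.trans
    ((congrArg (· *ᵥ v) hxy).trans (key y)))
  exact Prod.ext (congrFun h 0) (congrFun h 1)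

/-- `A` has two distinct eigenvalues in the base ring, expressed through its trace and
determinant. -/
def HasDistinctEigenvalues (A : Matrix (Fin 2) (Fin 2) R) : Prop :=
  ∃ a b, a ≠ b ∧ A.trace = a + b ∧ A.det = a * b

end CyclicTwo

section SplitSemisimple

open Module Polynomial

variable {k : Type*} [Field k] {A : Matrix (Fin 2) (Fin 2) k}

theorem charpoly_eq_mul_X_sub_C {a b : k} (htr : A.trace = a + b) (hdet : A.det = a * b) :
    A.charpoly = (X - C a) * (X - C b) := by
  rw [Matrix.charpoly_fin_two, htr, hdet]
  simp only [map_add, map_mul]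
  ring

theorem eq_algebraMap_of_isSemisimple {a : k} (hA : End.IsSemisimple (Matrix.toLin' A))
    (hsq : (A - algebraMap k _ a) ^ 2 = 0) : A = algebraMap k _ a := by
  have hmap : Matrix.toLinAlgEquiv' (A - algebraMap k _ a) =
      Matrix.toLin' A - algebraMap k (End k (Fin 2 → k)) a := by
    rw [map_sub, AlgEquiv.commutes]
    rfl
  have hnil : IsNilpotent (Matrix.toLin' A - algebraMap k (End k (Fin 2 → k)) a) :=
    ⟨2, by rw [← hmap, ← map_pow, hsq, map_zero]⟩
  have hzero := End.eq_zero_of_isNilpotent_isSemisimple hnil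
    (End.isSemisimple_sub_algebraMap_iff.2 hA)
  rw [← hmap, EmbeddingLike.map_eq_zero_iff] at hzero
  exact sub_eq_zero.1 hzero

theorem IsCyclicMatrix.hasDistinctEigenvalues (hA : IsCyclicMatrix A)
    (hs : IsSplitSemisimple A) : HasDistinctEigenvalues A := by
  obtain ⟨a, ha⟩ := hs.1.exists_eval_eq_zero (by rw [Matrix.charpoly_degree_eq_dim]; simp)
  have hdet : A.det = a * (A.trace - a) := by
    simp only [Matrix.charpoly_fin_two, eval_add, eval_sub, eval_pow, eval_X, eval_mul,
      eval_C] at ha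
    linear_combination ha
  have htr : A.trace = a + (A.trace - a) := by ring
  refine ⟨a, A.trace - a, fun hab => ?_, htr, hdet⟩
  have hsq := Matrix.aeval_self_charpoly A
  rw [charpoly_eq_mul_X_sub_C htr hdet, ← hab, ← sq, map_pow, map_sub, aeval_X, aeval_C] at hsq
  exact not_isCyclicMatrix_algebraMap a (eq_algebraMap_of_isSemisimple hs.2 hsq ▸ hA)

theorem HasDistinctEigenvalues.isSplitSemisimple (h : HasDistinctEigenvalues A) :
    IsSplitSemisimple A := by
  obtain ⟨a, b, hab, htr, hdet⟩ := h
  have hpoly := charpoly_eq_mul_X_sub_C htr hdet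
  refine ⟨hpoly ▸ (Splits.X_sub_C a).mul (Splits.X_sub_C b),
    End.isSemisimple_of_squarefree_aeval_eq_zero (p := A.charpoly) ?_ ?_⟩
  · rw [hpoly, squarefree_mul_iff]
    exact ⟨(isCoprime_X_sub_C_of_isUnit_sub (sub_ne_zero.2 hab).isUnit).isRelPrime,
      (irreducible_X_sub_C a).squarefree, (irreducible_X_sub_C b).squarefree⟩
  · rw [← Matrix.charpoly_toLin']
    exact LinearMap.aeval_self_charpoly _

theorem IsCyclicMatrix.isSplitSemisimple_iff (hA : IsCyclicMatrix A) :
    IsSplitSemisimple A ↔ HasDistinctEigenvalues A :=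
  ⟨hA.hasDistinctEigenvalues, HasDistinctEigenvalues.isSplitSemisimple⟩

end SplitSemisimple

/-! ### Diagonalization over a local ring -/

section Diagonalization

open Polynomial

variable {R k : Type*} [CommRing R] [IsLocalRing R]

theorem isNilpotent_of_not_isUnit [IsArtinianRing R] {x : R} (hx : ¬ IsUnit x) :
    IsNilpotent x := by
  obtain ⟨n, hn⟩ := IsArtinianRing.isNilpotent_jacobson_bot (R := R)
  rw [jacobson_eq_maximalIdeal ⊥ bot_ne_top] at hn
  exact ⟨n, by simpa [hn] using Ideal.pow_mem_pow ((mem_maximalIdeal x).2 hx) n⟩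

theorem HasDistinctEigenvalues.exists_lift [IsArtinianRing R] [Field k] {f : R →+* k}
    [IsLocalHom f] (hf : Function.Surjective f) {A : Matrix (Fin 2) (Fin 2) R}
    (h : HasDistinctEigenvalues (A.map f)) :
    ∃ α β, IsUnit (α - β) ∧ A.trace = α + β ∧ A.det = α * β := by
  obtain ⟨a, b, hab, htr, hdet⟩ := h
  obtain ⟨x, rfl⟩ := hf a
  have htr' : f A.trace = f x + b := (AddMonoidHom.map_trace f A).trans htr
  have hdet' : f A.det = f x * b := (f.map_det A).trans hdet
  have hroot : ¬ IsUnit (aeval x (X ^ 2 - C A.trace * X + C A.det)) := fun h => by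
    have h0 := (h.map f).ne_zero
    simp only [map_add, map_sub, map_mul, map_pow, aeval_X, aeval_C, Algebra.algebraMap_self,
      RingHom.id_apply, htr', hdet'] at h0
    exact h0 (by ring)
  have hderiv : IsUnit (aeval x (derivative (X ^ 2 - C A.trace * X + C A.det))) := by
    refine isUnit_of_map_unit f _ (isUnit_iff_ne_zero.2 ?_)
    have hderiv_eq : aeval x (derivative (X ^ 2 - C A.trace * X + C A.det)) = 2 * x - A.trace := by
      simp [one_add_one_eq_two]
    rw [hderiv_eq, map_sub, htr', map_mul, map_ofNat]
    exact fun h0 => hab (by linear_combination h0)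
  obtain ⟨α, ⟨hα, hαroot⟩, -⟩ :=
    existsUnique_nilpotent_sub_and_aeval_eq_zero (isNilpotent_of_not_isUnit hroot) hderiv
  have hfα : f x = f α := sub_eq_zero.1 (map_sub f x α ▸ (hα.map f).eq_zero)
  simp only [map_add, map_sub, map_mul, map_pow, aeval_X, aeval_C, Algebra.algebraMap_self,
    RingHom.id_apply] at hαroot
  refine ⟨α, A.trace - α, ?_, by ring, by linear_combination hαroot⟩
  refine isUnit_of_map_unit f _ (isUnit_iff_ne_zero.2 ?_)
  rw [map_sub, map_sub, htr', ← hfα, add_sub_cancel_left]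
  exact sub_ne_zero.2 hab

theorem exists_conj_eq_diag_of_isUnit {R : Type*} [CommRing R] {A : Matrix (Fin 2) (Fin 2) R}
    {α β : R} (htr : A.trace = α + β) (hdet : A.det = α * β) (h : IsUnit (α - β))
    (hA : IsUnit (A 0 0 - β)) :
    ∃ g : SL(2, R), (g : Matrix (Fin 2) (Fin 2) R) * A * (g⁻¹ : SL(2, R)) =
      !![α, 0; 0, β] := by
  obtain ⟨e, he⟩ := (hA.mul h.neg).exists_right_inv
  rw [Matrix.trace_fin_two] at htr
  rw [Matrix.det_fin_two] at hdet
  let g : SL(2, R) := ⟨!![e * (A 0 0 - β), A 0 1; e * A 1 0, β - A 0 0], by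
    rw [Matrix.det_fin_two_of]
    linear_combination he - e * (A 0 0 * htr - hdet)⟩
  have hg : A * g = (g : Matrix (Fin 2) (Fin 2) R) * !![α, 0; 0, β] := by
    ext i j
    fin_cases i <;> fin_cases j <;> simp [g, Matrix.mul_apply, Fin.sum_univ_two]
    · linear_combination e * (A 0 0 * htr - hdet)
    · ring
    · linear_combination A 1 0 * e * htr
    · linear_combination β * htr - hdet
  refine ⟨g⁻¹, ?_⟩
  rw [inv_inv, mul_assoc, hg, ← mul_assoc, ← Matrix.SpecialLinearGroup.coe_mul, inv_mul_cancel,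
    Matrix.SpecialLinearGroup.coe_one, one_mul]

theorem HasDistinctEigenvalues.exists_conj_eq_diag [IsArtinianRing R] [Field k] {f : R →+* k}
    [IsLocalHom f] (hf : Function.Surjective f) {A : Matrix (Fin 2) (Fin 2) R}
    (h : HasDistinctEigenvalues (A.map f)) :
    ∃ (g : SL(2, R)) (a b : R), IsUnit (a - b) ∧
      (g : Matrix (Fin 2) (Fin 2) R) * A * (g⁻¹ : SL(2, R)) = !![a, 0; 0, b] := by
  obtain ⟨α, β, hαβ, htr, hdet⟩ := h.exists_lift hf
  have hsplit : IsUnit ((A 0 0 - β) + (α - A 0 0)) := by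
    convert hαβ using 1
    ring
  rcases isUnit_or_isUnit_of_isUnit_add hsplit with hA | hA
  · exact (exists_conj_eq_diag_of_isUnit htr hdet hαβ hA).imp fun g hg => ⟨α, β, hαβ, hg⟩
  · exact (exists_conj_eq_diag_of_isUnit (htr.trans (add_comm _ _)) (hdet.trans (mul_comm _ _))
      (neg_sub α β ▸ hαβ.neg) (neg_sub α (A 0 0) ▸ hA.neg)).imp
      fun g hg => ⟨β, α, neg_sub α β ▸ hαβ.neg, hg⟩

end Diagonalization

/-! ### The bound through the general linear group -/

section GeneralLinear

theorem exists_eq_add_smul_of_map_eq {R R' m n : Type*} [CommRing R] [CommRing R'] {r : R →+* R'}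
    {p : R} (hr : ∀ x, r x = 0 → p ∣ x) {M D : Matrix m n R} (h : D.map r = M.map r) :
    ∃ X : Matrix m n R, M = D + p • X := by
  have hdvd (i j) : p ∣ M i j - D i j := hr _ <| by
    rw [map_sub, sub_eq_zero]
    exact (congrFun (congrFun h i) j).symm
  choose X hX using hdvd
  refine ⟨Matrix.of X, Matrix.ext fun i j => ?_⟩
  rw [Matrix.add_apply, Matrix.smul_apply, Matrix.of_apply, smul_eq_mul, ← hX, add_sub_cancel]

variable {R R' n : Type*} [CommRing R] [CommRing R'] [Fintype n] [DecidableEq n]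

/-- The centralizer in `GL n R` of a matrix that need not be invertible: the stabilizer of the
matrix under conjugation. -/
def glCentralizer (A : Matrix n n R) : Subgroup (GL n R) :=
  (Submonoid.centralizer {A}).units

theorem mem_glCentralizer {A : Matrix n n R} {g : GL n R} :
    g ∈ glCentralizer A ↔ Commute (g : Matrix n n R) A := by
  simp only [glCentralizer, Submonoid.mem_units_iff, Submonoid.mem_centralizer_iff,
    Set.mem_singleton_iff, forall_eq]
  exact ⟨fun h => h.1.symm, fun h => ⟨h.symm, h.units_inv_left.symm⟩⟩

theorem exists_mem_adjoin_map_eq {r : R →+* R'} (hr : Function.Surjective r) (A : Matrix n n R)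
    {C : Matrix n n R'} (hC : C ∈ Algebra.adjoin R' {A.map r}) :
    ∃ D ∈ Algebra.adjoin R {A}, D.map r = C := by
  rw [Algebra.adjoin_singleton_eq_range_aeval] at hC
  obtain ⟨P, rfl⟩ := hC
  obtain ⟨Q, rfl⟩ := Polynomial.map_surjective r hr P
  refine ⟨Polynomial.aeval A Q, Algebra.adjoin_singleton_eq_range_aeval R A ▸ ⟨Q, rfl⟩, ?_⟩
  refine Polynomial.map_aeval_eq_aeval_map (φ := r) (ψ := r.mapMatrix (m := n)) ?_ Q A
  refine RingHom.ext fun x => ?_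
  ext i j
  simp [Matrix.algebraMap_matrix_apply, apply_ite r]

end GeneralLinear

section OrbitBound

open Module

variable {R R' : Type*} [CommRing R] [CommRing R'] {n : ℕ} {p : R} {r : R →+* R'}
  {A : Matrix (Fin n) (Fin n) R}

theorem exists_eq_add_smul_of_commute_map (hr : Function.Surjective r)
    (hr0 : ∀ x, r x = 0 → p ∣ x) (hA : IsCyclicMatrix (A.map r)) {M : Matrix (Fin n) (Fin n) R}
    (h : Commute (M.map r) (A.map r)) :
    ∃ D ∈ Algebra.adjoin R {A}, ∃ X : Matrix (Fin n) (Fin n) R, M = D + p • X := by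
  obtain ⟨D, hD, hDM⟩ := exists_mem_adjoin_map_eq hr A (hA.mem_adjoin_of_commute h)
  exact ⟨D, hD, exists_eq_add_smul_of_map_eq hr0 hDM⟩

variable {𝕜 V : Type*} [Field 𝕜] [IsAlgClosed 𝕜] [AddCommGroup V] [Module 𝕜 V]
  [FiniteDimensional 𝕜 V] {ψ : AddChar R 𝕜} {v : V}

/-- On the eigenspace of `A`, the centralizer of `A` acts through commuting operators since, modulo
`p`, it consists of polynomials in `A`. -/
theorem exists_eigenvector_of_mem_glCentralizer_map {σ : Representation 𝕜 (GL (Fin n) R) V}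
    (hp : p * p = 0) (hr : Function.Surjective r) (hr0 : ∀ x, r x = 0 → p ∣ x)
    (hA : IsCyclicMatrix (A.map r)) (h0 : v ≠ 0)
    (hv : v ∈ congruenceEigenspace (Units.coeHom _) p ψ σ A) :
    ∃ w ≠ 0, ∀ g, Matrix.GeneralLinearGroup.map r g ∈ glCentralizer (A.map r) →
      ∃ c : 𝕜, σ g w = c • w := by
  have hform (g : (glCentralizer (A.map r)).comap (Matrix.GeneralLinearGroup.map r)) :
      ∃ D ∈ Algebra.adjoin R {A}, ∃ X : Matrix (Fin n) (Fin n) R, (g : GL (Fin n) R) = D + p • X :=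
    exists_eq_add_smul_of_commute_map hr hr0 hA (mem_glCentralizer.1 g.2)
  obtain ⟨w, -, hw0, hw⟩ := exists_common_eigenvector_mem
    (fun g : (glCentralizer (A.map r)).comap (Matrix.GeneralLinearGroup.map r) => σ g)
    (E := congruenceEigenspace (Units.coeHom _) p ψ σ A)
    ((Submodule.ne_bot_iff _).2 ⟨v, hv, h0⟩)
    (fun g u hu => by
      obtain ⟨D, hD, X, hX⟩ := hform g
      exact apply_mem_congruenceEigenspace hp (mem_commutantMod_of_eq_add_smul hp hD hX) hu)
    (fun g h u hu => by
      obtain ⟨C, hC, X, hX⟩ := hform g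
      obtain ⟨D, hD, Y, hY⟩ := hform h
      exact apply_comm_of_mem_adjoin hp hu hC hD hX hY)
  exact ⟨w, hw0, fun g hg => hw ⟨g, hg⟩⟩

theorem finrank_le_index_glCentralizer_of_gl {σ : Representation 𝕜 (GL (Fin n) R) V}
    [σ.IsIrreducible] [Finite R] (hp : p * p = 0) (hr : Function.Surjective r)
    (hr0 : ∀ x, r x = 0 → p ∣ x) (hA : IsCyclicMatrix (A.map r)) (h0 : v ≠ 0)
    (hv : v ∈ congruenceEigenspace (Units.coeHom _) p ψ σ A) :
    finrank 𝕜 V ≤ (glCentralizer (A.map r)).index := by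
  obtain ⟨w, hw0, hw⟩ := exists_eigenvector_of_mem_glCentralizer_map hp hr hr0 hA h0 hv
  have := Finite.of_surjective r hr
  refine (finrank_le_index σ hw0
    ((glCentralizer (A.map r)).comap (Matrix.GeneralLinearGroup.map r)) hw).trans ?_
  rw [Subgroup.index_comap, ← Subgroup.relIndex_top_right]
  exact Subgroup.relIndex_le_of_le_right le_top
    ((Subgroup.relIndex_top_right _).trans_ne Subgroup.index_ne_zero_of_finite)

theorem finrank_le_index_glCentralizer [Finite R]
    {ρ : Representation 𝕜 (Matrix.SpecialLinearGroup (Fin n) R) V} [ρ.IsIrreducible]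
    [NeZero (Nat.card (GL (Fin n) R) : 𝕜)] (hp : p * p = 0)
    (hr : Function.Surjective r) (hr0 : ∀ x, r x = 0 → p ∣ x) (hA : IsCyclicMatrix (A.map r))
    (h0 : v ≠ 0) (hv : v ∈ congruenceEigenspace coeMonoidHom p ψ ρ A) :
    finrank 𝕜 V ≤ (glCentralizer (A.map r)).index := by
  obtain ⟨d, σ, f, hσ, hf⟩ := exists_isIrreducible_extending toGL ρ toGL_injective
  have hfv : f v ∈ congruenceEigenspace (Units.coeHom _) p ψ σ A := by
    intro γ B hdet hγ
    obtain ⟨γ, rfl⟩ : ∃ γ', toGL γ' = γ := ⟨⟨γ, hdet⟩, Units.ext rfl⟩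
    rw [← map_smul, ← hv γ B hdet hγ]
    exact (Representation.IntertwiningMap.isIntertwining _ _ f γ v).symm
  have hfv0 : f v ≠ 0 := (map_ne_zero_iff f hf).2 h0
  refine (LinearMap.finrank_le_finrank_of_injective (f := f.toLinearMap) hf).trans ?_
  exact finrank_le_index_glCentralizer_of_gl hp hr hr0 hA hfv0 hfv

end OrbitBound

/-! ### Counting -/

section Preimages

theorem card_eq_two_mul_of_fibers {X Y : Type*} {F : X → Y} (hF : Function.Surjective F)
    {i : X → X} (hi : ∀ x, x ≠ i x) (h : ∀ x y, F x = F y ↔ y = x ∨ y = i x) :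
    Nat.card X = 2 * Nat.card Y := by
  have hfiber (y : Y) : Nat.card {x // F x = y} = 2 := by
    obtain ⟨x, rfl⟩ := hF y
    have hset : {z | F z = F x} = {x, i x} := Set.ext fun z => eq_comm.trans (h x z)
    exact (congrArg Set.ncard hset).trans (Set.ncard_pair (hi x))
  have (y : Y) : Finite {x // F x = y} := Nat.finite_of_card_ne_zero (by simp [hfiber])
  let e (y : Y) : {x // F x = y} ≃ Fin 2 := Finite.equivFinOfCardEq (hfiber y)
  rw [Nat.card_congr <| (Equiv.sigmaFiberEquiv F).symm.trans <|
    (Equiv.sigmaCongrRight e).trans (Equiv.sigmaEquivProd Y (Fin 2)), Nat.card_prod,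
    Nat.card_fin, mul_comm]

theorem card_preimage_eq {M N : Type*} [AddGroup M] [AddGroup N] {φ : M →+ N}
    (hφ : Function.Surjective φ) (P : N → Prop) :
    Nat.card {x // P (φ x)} = Nat.card {y // P y} * Nat.card φ.ker := by
  rw [← Nat.card_prod, ← Nat.card_congr (Equiv.sigmaEquivProd _ _)]
  exact Nat.card_congr <| (Equiv.sigmaSubtypeFiberEquivSubtype φ fun _ => Iff.rfl).symm.trans <|
    Equiv.sigmaCongrRight fun y => AddMonoidHom.fiberEquivKerOfSurjective hφ y

theorem card_preimage_mul_card {M N : Type*} [AddGroup M] [AddGroup N] {φ : M →+ N}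
    (hφ : Function.Surjective φ) (P : N → Prop) :
    Nat.card {x // P (φ x)} * Nat.card N = Nat.card {y // P y} * Nat.card M := by
  rw [card_preimage_eq hφ, mul_assoc, ← AddSubgroup.card_mul_index φ.ker, AddSubgroup.index_ker,
    AddMonoidHom.range_eq_top.2 hφ, AddSubgroup.card_top]

theorem card_isUnit (R : Type*) [Monoid R] : Nat.card {x : R // IsUnit x} = Nat.card Rˣ :=
  (Nat.card_congr (Submonoid.unitsTypeEquivIsUnitSubmonoid (M := R)).toEquiv).symm

theorem card_units_mul_card {R S : Type*} [Ring R] [Ring S] {f : R →+* S} [IsLocalHom f]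
    (hf : Function.Surjective f) :
    Nat.card Rˣ * Nat.card S = Nat.card Sˣ * Nat.card R := by
  have h := card_preimage_mul_card (φ := f.toAddMonoidHom) hf IsUnit
  simp only [RingHom.toAddMonoidHom_eq_coe, AddMonoidHom.coe_coe, isUnit_map_iff] at h
  rwa [card_isUnit, card_isUnit] at h

theorem card_span_singleton {R : Type*} [CommRing R] (a : R) :
    Nat.card (Ideal.span {a}) = (AddMonoidHom.mulLeft a).ker.index := by
  rw [AddSubgroup.index_ker]
  refine Nat.card_congr (Equiv.subtypeEquivRight fun x => ?_)
  rw [Ideal.mem_span_singleton']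
  simp only [AddMonoidHom.mem_range, AddMonoidHom.coe_mulLeft, mul_comm a]

theorem IsSelfAnnihilating.card_span_singleton_sq {R : Type*} [CommRing R] {p : R}
    (hp : IsSelfAnnihilating p) : Nat.card (Ideal.span {p}) ^ 2 = Nat.card R := by
  have hker : (AddMonoidHom.mulLeft p).ker = (Ideal.span {p}).toAddSubgroup :=
    AddSubgroup.ext fun x => (hp x).trans Ideal.mem_span_singleton.symm
  rw [← AddSubgroup.card_mul_index (AddMonoidHom.mulLeft p).ker, ← card_span_singleton, hker, sq]
  rfl

theorem IsSelfAnnihilating.card_quotient_sq {R : Type*} [CommRing R] [Finite R] {p : R}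
    (hp : IsSelfAnnihilating p) : Nat.card (R ⧸ Ideal.span {p}) ^ 2 = Nat.card R := by
  have hmul := Submodule.card_eq_card_quotient_mul_card (Ideal.span {p})
  have hsq := hp.card_span_singleton_sq
  rw [← hsq, sq] at hmul
  rw [← Nat.eq_of_mul_eq_mul_left Nat.card_pos hmul, hsq]

theorem IsSocleGenerator.card_span_singleton {R k : Type*} [CommRing R] [Field k] {s : R}
    (hs : IsSocleGenerator s) {f : R →+* k} [IsLocalHom f] (hf : Function.Surjective f) :
    Nat.card (Ideal.span {s}) = Nat.card k := by
  have : IsLocalRing R := RingHom.domain_isLocalRing f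
  have hker : (AddMonoidHom.mulLeft s).ker = f.toAddMonoidHom.ker := by
    refine AddSubgroup.ext fun x => ?_
    rw [AddMonoidHom.mem_ker, AddMonoidHom.mem_ker, AddMonoidHom.coe_mulLeft]
    refine ⟨fun h => ?_, fun h => hs.mul_eq_zero fun hx => (hx.map f).ne_zero h⟩
    by_contra hx
    exact hs.1 ((isUnit_of_map_unit f x (isUnit_iff_ne_zero.2 hx)).mul_left_eq_zero.1 h)
  rw [SLTwo.card_span_singleton, hker, AddSubgroup.index_ker, AddMonoidHom.range_eq_top.2 hf,
    AddSubgroup.card_top]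

end Preimages

section GeneralLinearCard

variable {R k : Type*} [CommRing R] [Field k] {f : R →+* k}

theorem card_matrix_fin_two (R : Type*) :
    Nat.card (Matrix (Fin 2) (Fin 2) R) = Nat.card R ^ 4 := by
  rw [Matrix, Nat.card_fun, Nat.card_fun, ← pow_mul, Nat.card_fin]

theorem isLocalHom_mapMatrix {S n : Type*} [CommRing S] [Fintype n] [DecidableEq n] (f : R →+* S)
    [IsLocalHom f] : IsLocalHom (f.mapMatrix (m := n)) where
  map_nonunit M hM := by
    rw [Matrix.isUnit_iff_isUnit_det, ← RingHom.map_det] at hM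
    exact (Matrix.isUnit_iff_isUnit_det M).2 (hM.of_map f)

theorem card_gl_fin_two_mul [Finite k] [IsLocalHom f] (hf : Function.Surjective f) :
    Nat.card (GL (Fin 2) R) * Nat.card k ^ 4 =
      (Nat.card k ^ 2 - 1) * (Nat.card k ^ 2 - Nat.card k) * Nat.card R ^ 4 := by
  have : Fintype k := Fintype.ofFinite k
  have : IsLocalHom (f.mapMatrix (m := Fin 2)) := isLocalHom_mapMatrix f
  have h := card_units_mul_card (f := f.mapMatrix (m := Fin 2)) fun N =>
    ⟨N.map fun x => (hf x).choose, Matrix.ext fun i j => (hf _).choose_spec⟩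
  rw [card_matrix_fin_two, card_matrix_fin_two] at h
  refine h.trans (congrArg (· * Nat.card R ^ 4) ?_)
  rw [Matrix.card_GL_field, Fin.prod_univ_two, Nat.card_eq_fintype_card]
  simp only [Fin.val_zero, Fin.val_one, pow_zero, pow_one]

theorem card_gl_eq_card_sl_mul {n : Type*} [Fintype n] [DecidableEq n] [Nonempty n] :
    Nat.card (GL n R) = Nat.card (Matrix.SpecialLinearGroup n R) * Nat.card Rˣ := by
  rw [← (Matrix.GeneralLinearGroup.det (n := n) (R := R)).ker.card_mul_index, Subgroup.index_ker,
    MonoidHom.range_eq_top.2 Matrix.GeneralLinearGroup.det_surjective, Subgroup.card_top]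
  congr 1
  exact Nat.card_congr
    { toFun := fun g => ⟨g.1, congrArg Units.val g.2⟩
      invFun := fun g => ⟨Matrix.SpecialLinearGroup.toGL g, Units.ext g.2⟩
      left_inv := fun g => Subtype.ext (Units.ext rfl)
      right_inv := fun g => rfl }

end GeneralLinearCard

section CentralizerCard

theorem det_smul_one_add_smul {R : Type*} [CommRing R] (A : Matrix (Fin 2) (Fin 2) R) (x y : R) :
    (x • (1 : Matrix (Fin 2) (Fin 2) R) + y • A).det =
      x ^ 2 + x * y * A.trace + y ^ 2 * A.det := by
  simp only [Matrix.det_fin_two, Matrix.trace_fin_two, Matrix.add_apply, Matrix.smul_apply,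
    Matrix.one_apply, smul_eq_mul, Fin.isValue, zero_ne_one, one_ne_zero, if_true, if_false]
  ring

variable {R k : Type*} [CommRing R] [Field k] {f : R →+* k}

theorem eq_of_det_smul_one_add_smul_eq_zero {A : Matrix (Fin 2) (Fin 2) k}
    (hA : ¬ HasDistinctEigenvalues A) {x x' y : k}
    (h : (x • (1 : Matrix (Fin 2) (Fin 2) k) + y • A).det = 0)
    (h' : (x' • (1 : Matrix (Fin 2) (Fin 2) k) + y • A).det = 0) : x = x' := by
  rw [det_smul_one_add_smul] at h h'
  by_contra hne
  have hy : y ≠ 0 := by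
    rintro rfl
    simp only [mul_zero, zero_mul, add_zero, ne_eq, OfNat.ofNat_ne_zero, not_false_eq_true,
      zero_pow, pow_eq_zero_iff] at h h'
    exact hne (h.trans h'.symm)
  have hsum : x + x' + y * A.trace = 0 :=
    (mul_eq_zero.1 (by linear_combination h - h')).resolve_left (sub_ne_zero.2 hne)
  refine hA ⟨-x / y, -x' / y, ?_, ?_, ?_⟩
  · rw [Ne, div_left_inj' hy, neg_inj]
    exact hne
  · field_simp
    linear_combination hsum
  · field_simp
    linear_combination h - x * hsum

theorem card_sq_sub_card_le [Finite k] {A : Matrix (Fin 2) (Fin 2) k}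
    (hA : ¬ HasDistinctEigenvalues A) :
    Nat.card k ^ 2 - Nat.card k ≤
      Nat.card {x : k × k // IsUnit (x.1 • (1 : Matrix (Fin 2) (Fin 2) k) + x.2 • A)} := by
  have hzero : Nat.card {x : k × k // ¬ IsUnit (x.1 • (1 : Matrix (Fin 2) (Fin 2) k) + x.2 • A)} ≤
      Nat.card k := by
    refine Nat.card_le_card_of_injective (fun x => x.1.2) ?_
    rintro ⟨⟨x, y⟩, h⟩ ⟨⟨x', _⟩, h'⟩ rfl
    rw [Matrix.isUnit_iff_isUnit_det, isUnit_iff_ne_zero, not_not] at h h'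
    cases eq_of_det_smul_one_add_smul_eq_zero hA h h'
    rfl
  classical
  have htotal := Nat.card_congr (Equiv.sumCompl fun x : k × k =>
    IsUnit (x.1 • (1 : Matrix (Fin 2) (Fin 2) k) + x.2 • A))
  rw [Nat.card_sum, Nat.card_prod, ← sq] at htotal
  omega

theorem card_isUnit_smul_one_add_smul_le [Finite R] {A : Matrix (Fin 2) (Fin 2) R}
    (hA : IsCyclicMatrix A) :
    Nat.card {x : R × R // IsUnit (x.1 • (1 : Matrix (Fin 2) (Fin 2) R) + x.2 • A)} ≤
      Nat.card (glCentralizer A) := by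
  refine Nat.card_le_card_of_injective (fun x => ⟨x.2.unit, ?_⟩) fun x y h => ?_
  · exact mem_glCentralizer.2 (((Commute.one_left A).smul_left _).add_left
      ((Commute.refl A).smul_left _))
  · exact Subtype.ext (hA.smul_one_add_smul_injective
      (congrArg (fun g : glCentralizer A => ((g : GL (Fin 2) R) : Matrix (Fin 2) (Fin 2) R)) h))

theorem card_glCentralizer_mul_ge [Finite R] [Finite k] [IsLocalHom f]
    (hf : Function.Surjective f) {A : Matrix (Fin 2) (Fin 2) R} (hA : IsCyclicMatrix A)
    (hA' : ¬ HasDistinctEigenvalues (A.map f)) :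
    (Nat.card k ^ 2 - Nat.card k) * Nat.card R ^ 2 ≤
      Nat.card (glCentralizer A) * Nat.card k ^ 2 := by
  have : IsLocalHom (f.mapMatrix (m := Fin 2)) := isLocalHom_mapMatrix f
  have hmap (x : R × R) : f x.1 • (1 : Matrix (Fin 2) (Fin 2) k) + f x.2 • A.map f =
      f.mapMatrix (x.1 • (1 : Matrix (Fin 2) (Fin 2) R) + x.2 • A) := by
    ext i j
    simp [Matrix.one_apply, apply_ite f]
  have h := card_preimage_mul_card (φ := f.toAddMonoidHom.prodMap f.toAddMonoidHom)
    (hf.prodMap hf) fun x => IsUnit (x.1 • (1 : Matrix (Fin 2) (Fin 2) k) + x.2 • A.map f)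
  simp only [AddMonoidHom.coe_prodMap, RingHom.toAddMonoidHom_eq_coe, AddMonoidHom.coe_coe,
    Prod.map_fst, Prod.map_snd, hmap, isUnit_map_iff, Nat.card_prod, ← sq] at h
  calc (Nat.card k ^ 2 - Nat.card k) * Nat.card R ^ 2
      ≤ _ * Nat.card R ^ 2 := Nat.mul_le_mul_right _ (card_sq_sub_card_le hA')
    _ = _ * Nat.card k ^ 2 := h.symm
    _ ≤ _ := Nat.mul_le_mul_right _ (card_isUnit_smul_one_add_smul_le hA)

theorem index_glCentralizer_mul_le [Finite R] [Finite k] [IsLocalHom f]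
    (hf : Function.Surjective f) {A : Matrix (Fin 2) (Fin 2) R} (hA : IsCyclicMatrix A)
    (hA' : ¬ HasDistinctEigenvalues (A.map f)) :
    (glCentralizer A).index * Nat.card k ^ 2 ≤ (Nat.card k ^ 2 - 1) * Nat.card R ^ 2 := by
  have hpos : 0 < (Nat.card k ^ 2 - Nat.card k) * Nat.card R ^ 2 := by
    refine Nat.mul_pos (Nat.sub_pos_of_lt ?_) (pow_pos Nat.card_pos 2)
    exact lt_self_pow₀ Finite.one_lt_card one_lt_two
  refine Nat.le_of_mul_le_mul_right ?_ hpos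
  calc (glCentralizer A).index * Nat.card k ^ 2 *
        ((Nat.card k ^ 2 - Nat.card k) * Nat.card R ^ 2)
      ≤ (glCentralizer A).index * Nat.card k ^ 2 *
        (Nat.card (glCentralizer A) * Nat.card k ^ 2) :=
        Nat.mul_le_mul_left _ (card_glCentralizer_mul_ge hf hA hA')
    _ = Nat.card (GL (Fin 2) R) * Nat.card k ^ 4 := by
        rw [← (glCentralizer A).card_mul_index]
        ring
    _ = (Nat.card k ^ 2 - 1) * Nat.card R ^ 2 *
        ((Nat.card k ^ 2 - Nat.card k) * Nat.card R ^ 2) := by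
        rw [card_gl_fin_two_mul hf]
        ring

end CentralizerCard

section DiagSubgroupCard

variable {R k : Type*} [CommRing R] [Field k] {f : R →+* k} {p s : R}

theorem card_diagSubgroup (hp : p * p = 0) :
    Nat.card (diagSubgroup p) = Nat.card Rˣ * Nat.card (Ideal.span {p}) ^ 2 := by
  have hzero (x y : Ideal.span {p}) : (x : R) * y = 0 := by
    obtain ⟨a, ha⟩ := Ideal.mem_span_singleton.1 x.2
    obtain ⟨b, hb⟩ := Ideal.mem_span_singleton.1 y.2
    rw [ha, hb]
    linear_combination a * b * hp
  rw [sq, ← Nat.card_prod, ← Nat.card_prod]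
  exact Nat.card_congr
    { toFun := fun g => (diagUnit hp g, ⟨g.1 0 1, Ideal.mem_span_singleton.2 g.2.1⟩,
        ⟨g.1 1 0, Ideal.mem_span_singleton.2 g.2.2⟩)
      invFun := fun x => ⟨⟨!![(x.1 : R), x.2.1; x.2.2, ((x.1⁻¹ : Rˣ) : R)], by
          rw [Matrix.det_fin_two_of, Units.mul_inv, hzero, sub_zero]⟩,
        Ideal.mem_span_singleton.1 x.2.1.2, Ideal.mem_span_singleton.1 x.2.2.2⟩
      left_inv := fun g => Subtype.ext (Subtype.ext (Matrix.eta_fin_two _).symm)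
      right_inv := fun x => Prod.ext (Units.ext rfl) rfl }

theorem index_diagSubgroup_mul_card [Finite R] [IsLocalHom f] (hf : Function.Surjective f)
    (hp : IsSelfAnnihilating p) :
    (diagSubgroup p).index * Nat.card k = (Nat.card k + 1) * Nat.card R := by
  have : Finite k := Finite.of_surjective f hf
  have hunits := card_units_mul_card hf
  have hgl := card_gl_fin_two_mul hf
  rw [card_gl_eq_card_sl_mul, ← (diagSubgroup p).card_mul_index, card_diagSubgroup hp.mul_self,
    hp.card_span_singleton_sq] at hgl
  rw [Nat.card_units] at hunits
  have hq : 1 < Nat.card k := Finite.one_lt_card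
  have hR : 0 < Nat.card R := Nat.card_pos
  generalize (diagSubgroup p).index = D, Nat.card Rˣ = u, Nat.card R = N, Nat.card k = q at *
  have hfactor : (q ^ 2 - 1) * (q ^ 2 - q) = (q - 1) ^ 2 * (q * (q + 1)) := by
    zify [hq.le, Nat.one_le_pow 2 q (by omega), Nat.le_self_pow two_ne_zero q]
    ring
  have hpos : 0 < (q - 1) ^ 2 * N ^ 3 * q :=
    Nat.mul_pos (Nat.mul_pos (pow_pos (Nat.sub_pos_of_lt hq) 2) (pow_pos hR 3)) (by omega)
  refine Nat.eq_of_mul_eq_mul_right hpos ?_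
  calc D * q * ((q - 1) ^ 2 * N ^ 3 * q) = ((q - 1) * N) ^ 2 * N * D * q ^ 2 := by ring
    _ = u * N * D * u * q ^ 4 := by rw [← hunits]; ring
    _ = (q + 1) * N * ((q - 1) ^ 2 * N ^ 3 * q) := by rw [hgl, hfactor]; ring

end DiagSubgroupCard

section UnitCharactersCard

theorem card_restrict_ne_one_mul {G M : Type*} [CommGroup G] [Finite G] [CommMonoid M]
    [HasEnoughRootsOfUnity M (Monoid.exponent G)] (H : Subgroup G) :
    Nat.card {τ : G →* Mˣ // MonoidHom.domRestrictHom H Mˣ τ ≠ 1} * Nat.card H =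
      (Nat.card H - 1) * Nat.card G := by
  classical
  have hker : Nat.card (MonoidHom.domRestrictHom H Mˣ).ker * Nat.card H = Nat.card G := by
    rw [CommGroup.card_domRestrictHom_ker, ← H.card_eq_card_quotient_mul_card_subgroup]
  have : Finite (G →* Mˣ) := Nat.finite_of_card_ne_zero <| by
    rw [CommGroup.card_monoidHom_of_hasEnoughRootsOfUnity]
    exact Nat.card_pos.ne'
  have htotal := Nat.card_congr (Equiv.sumCompl fun τ => τ ∈ (MonoidHom.domRestrictHom H Mˣ).ker)
  rw [Nat.card_sum, CommGroup.card_monoidHom_of_hasEnoughRootsOfUnity] at htotal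
  have hmul := congrArg (· * Nat.card H) htotal
  rw [add_mul, hker] at hmul
  rw [Nat.sub_mul, one_mul, mul_comm (Nat.card H)]
  exact Nat.eq_sub_of_add_eq' hmul

variable {R k : Type*} [CommRing R] [Field k] {f : R →+* k} {s : R}

/-- The units that are congruent to one modulo `s`. -/
def principalUnits (s : R) : Subgroup Rˣ :=
  (Units.map (Ideal.Quotient.mk (Ideal.span {s}) : R →* R ⧸ Ideal.span {s})).ker

theorem mem_principalUnits {u : Rˣ} : u ∈ principalUnits s ↔ s ∣ (u : R) - 1 := by
  rw [principalUnits, MonoidHom.mem_ker, Units.ext_iff, ← Ideal.mem_span_singleton,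
    ← Ideal.Quotient.eq]
  exact Iff.rfl

theorem card_principalUnits [IsLocalRing R] (hs : ¬ IsUnit s) :
    Nat.card (principalUnits s) = Nat.card (Ideal.span {s}) := by
  have hunit (x : Ideal.span {s}) : IsUnit (1 + (x : R)) := by
    obtain ⟨y, hy⟩ := Ideal.mem_span_singleton.1 x.2
    refine (IsLocalRing.isUnit_or_isUnit_of_add_one (a := 1 + (x : R)) (b := -x)
      (add_neg_cancel_right _ _)).resolve_right fun hx => hs ?_
    exact isUnit_of_dvd_unit ⟨-y, by rw [hy, mul_neg]⟩ hx
  exact Nat.card_congr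
    { toFun := fun u => ⟨u.1 - 1, Ideal.mem_span_singleton.2 (mem_principalUnits.1 u.2)⟩
      invFun := fun x => ⟨(hunit x).unit, mem_principalUnits.2 <| by
        rw [IsUnit.unit_spec, add_sub_cancel_left]
        exact Ideal.mem_span_singleton.1 x.2⟩
      left_inv := fun u => Subtype.ext (Units.ext (add_sub_cancel _ _))
      right_inv := fun x => Subtype.ext (add_sub_cancel_left _ _) }

theorem card_isPrimitiveUnitCharacter_mul [Finite R] [IsLocalHom f] {M : Type*} [CommMonoid M]
    [HasEnoughRootsOfUnity M (Monoid.exponent Rˣ)] (hf : Function.Surjective f)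
    (hs : IsSocleGenerator s) (hs' : ¬ IsUnit s) :
    Nat.card {τ : Rˣ →* Mˣ // IsPrimitiveUnitCharacter s τ} * Nat.card k ^ 2 =
      (Nat.card k - 1) ^ 2 * Nat.card R := by
  have : IsLocalRing R := RingHom.domain_isLocalRing f
  have hiff (τ : Rˣ →* Mˣ) : IsPrimitiveUnitCharacter s τ ↔
      MonoidHom.domRestrictHom (principalUnits s) Mˣ τ ≠ 1 := by
    simp [IsPrimitiveUnitCharacter, mem_principalUnits]
  have hunits := card_units_mul_card hf
  rw [Nat.card_units] at hunits
  have h := card_restrict_ne_one_mul (M := M) (principalUnits s)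
  rw [card_principalUnits hs', hs.card_span_singleton hf] at h
  simp only [← hiff] at h
  rw [sq, ← mul_assoc, h, mul_assoc, hunits, sq, mul_assoc]

end UnitCharactersCard

/-! ### Dimensions of the irreducible representations -/

section Dimension

open Module

theorem IsCyclicMatrix.of_map {R k : Type*} [CommRing R] [IsLocalRing R] [CommRing k]
    [IsLocalRing k] {f : R →+* k} [IsLocalHom f] {A : Matrix (Fin 2) (Fin 2) R}
    (hA : IsCyclicMatrix (A.map f)) : IsCyclicMatrix A := by
  simpa only [isCyclicMatrix_iff_isUnit_entries, Matrix.map_apply, ← map_sub,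
    isUnit_map_iff] using hA

variable {R 𝕜 V : Type*} [CommRing R] [Field 𝕜] [AddCommGroup V] [Module 𝕜 V] {p s : R}
  {ψ : AddChar R 𝕜} {ρ : Representation 𝕜 SL(2, R) V} {v : V} {A : Matrix (Fin 2) (Fin 2) R}

theorem IsSelfAnnihilating.mul_self_of_isSocleGenerator (hp : IsSelfAnnihilating p)
    (hs : IsSocleGenerator s) : s * s = 0 := by
  obtain ⟨c, rfl⟩ := hp.dvd_of_isSocleGenerator hs
  linear_combination c * c * hp.mul_self

theorem congruenceEigenspace_le_of_isSocleGenerator (hp : IsSelfAnnihilating p)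
    (hs : IsSocleGenerator s) :
    congruenceEigenspace coeMonoidHom p ψ ρ A ≤ congruenceEigenspace coeMonoidHom s ψ ρ A := by
  obtain ⟨c, rfl⟩ := hp.dvd_of_isSocleGenerator hs
  exact congruenceEigenspace_le_mul c

/-- If `A` is not cyclic then it is a scalar modulo non-units, hence invisible after multiplication
by `s`. -/
theorem isCyclicMatrix_of_apply_ne_one [IsLocalRing R] [ρ.IsIrreducible]
    (hp : IsSelfAnnihilating p) (hs : IsSocleGenerator s) (hv0 : v ≠ 0)
    (hv : v ∈ congruenceEigenspace coeMonoidHom p ψ ρ A) {γ : SL(2, R)}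
    {B : Matrix (Fin 2) (Fin 2) R} (hγ : coeMonoidHom γ = 1 + s • B) (hργ : ρ γ ≠ 1) :
    IsCyclicMatrix A := by
  by_contra hA
  simp only [isCyclicMatrix_iff_isUnit_entries, not_or] at hA
  obtain ⟨h01, h10, hdiag⟩ := hA
  have h0 : s * A 0 0 = s * A 1 1 := by rw [← sub_eq_zero, ← mul_sub, hs.mul_eq_zero hdiag]
  have hscalar : CongrModScalar s A 0 := by
    refine congrModScalar_of_entries (fun i j hij => ?_) fun i j => ?_
    · fin_cases i <;> fin_cases j <;>
        first | exact absurd rfl hij | simp [hs.mul_eq_zero h01, hs.mul_eq_zero h10]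
    · fin_cases i <;> fin_cases j <;> simp [h0]
  exact hργ <| apply_eq_one_of_congrModScalar_zero (hp.mul_self_of_isSocleGenerator hs) hv0
    (congruenceEigenspace_le_of_isSocleGenerator hp hs hv) hscalar γ.det_coe hγ

theorem exists_hasWeight_of_hasDistinctEigenvalues [IsAlgClosed 𝕜] [FiniteDimensional 𝕜 V]
    [Finite R] {k : Type*} [Field k] {f : R →+* k} [IsLocalHom f] (hf : Function.Surjective f)
    (hp : IsSelfAnnihilating p) (hs : IsSocleGenerator s) (hψ : ψ.IsPrimitive) (hv0 : v ≠ 0)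
    (hv : v ∈ congruenceEigenspace coeMonoidHom p ψ ρ A)
    (hA : HasDistinctEigenvalues (A.map f)) :
    ∃ τ : Rˣ →* 𝕜ˣ, IsPrimitiveUnitCharacter s τ ∧
      HasWeight ρ (diagCharacter hp.mul_self τ) := by
  have : IsLocalRing R := RingHom.domain_isLocalRing f
  obtain ⟨g, a, b, hab, hg⟩ := hA.exists_conj_eq_diag hf
  have hgv := congruenceEigenspace_conj hv g
  simp only [Matrix.SpecialLinearGroup.coeMonoidHom_apply, hg] at hgv
  exact exists_hasWeight_diagCharacter hp hs hψ hab
    ((map_ne_zero_iff _ (ρ.apply_bijective g).1).2 hv0) hgv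

theorem finrank_lt_index_diagSubgroup [IsAlgClosed 𝕜] [FiniteDimensional 𝕜 V] [Finite R]
    [NeZero (Nat.card (GL (Fin 2) R) : 𝕜)] [ρ.IsIrreducible] {k : Type*} [Field k] {f : R →+* k}
    [IsLocalHom f] (hf : Function.Surjective f) (hp : IsSelfAnnihilating p)
    (hA : IsCyclicMatrix A) (hA' : ¬ HasDistinctEigenvalues (A.map f)) (hv0 : v ≠ 0)
    (hv : v ∈ congruenceEigenspace coeMonoidHom p ψ ρ A) :
    finrank 𝕜 V < (diagSubgroup p).index := by
  have : Finite k := Finite.of_surjective f hf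
  have : Finite (R ⧸ Ideal.span {p}) := Finite.of_surjective _ Ideal.Quotient.mk_surjective
  let r := Ideal.Quotient.mk (Ideal.span {p})
  have hfp (x) (hx : x ∈ Ideal.span {p}) : f x = 0 := by
    obtain ⟨y, rfl⟩ := Ideal.mem_span_singleton.1 hx
    have hfp0 : f p = 0 := mul_self_eq_zero.1 <| by rw [← map_mul, hp.mul_self, map_zero]
    rw [map_mul, hfp0, zero_mul]
  let f' := Ideal.Quotient.lift (Ideal.span {p}) f hfp
  have hf' : Function.Surjective f' := Ideal.Quotient.lift_surjective_of_surjective _ hfp hf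
  have : IsLocalHom f' := ⟨fun x hx => by
    obtain ⟨y, rfl⟩ := Ideal.Quotient.mk_surjective x
    exact (hx.of_map f y).map r⟩
  have hcentralizer := index_glCentralizer_mul_le hf' (hA.map r) hA'
  have hdiag := index_diagSubgroup_mul_card hf hp
  have hle := finrank_le_index_glCentralizer hp.mul_self Ideal.Quotient.mk_surjective
    (fun x hx => Ideal.mem_span_singleton.1 (Ideal.Quotient.eq_zero_iff_mem.1 hx)) (hA.map r)
    hv0 hv
  rw [hp.card_quotient_sq] at hcentralizer
  have hq : 1 < Nat.card k := Finite.one_lt_card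
  refine hle.trans_lt (lt_of_mul_lt_mul_right (a := Nat.card k ^ 2) ?_ (Nat.zero_le _))
  calc (glCentralizer (A.map r)).index * Nat.card k ^ 2
      ≤ (Nat.card k ^ 2 - 1) * Nat.card R := hcentralizer
    _ < (Nat.card k ^ 2 + Nat.card k) * Nat.card R :=
      Nat.mul_lt_mul_of_pos_right (by omega) Nat.card_pos
    _ = (diagSubgroup p).index * Nat.card k ^ 2 := by
      linear_combination Nat.card k * hdiag.symm

end Dimension

section ComplexDimension

open Module

variable {R V : Type*} [CommRing R] [Finite R] [AddCommGroup V] [Module ℂ V] {p s : R}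
  {ψ : AddChar R ℂ} {ρ : Representation ℂ SL(2, R) V} {τ : Rˣ →* ℂˣ}

theorem exists_smul_apply_ne_one_of_hasWeight [IsLocalRing R] (hp : IsSelfAnnihilating p)
    (hs : IsSocleGenerator s) (hψ : ψ.IsPrimitive) (hτ : IsPrimitiveUnitCharacter s τ)
    (h : HasWeight ρ (diagCharacter hp.mul_self τ)) (χ : SL(2, R) → ℂ) :
    ∃ γ B, coeMonoidHom γ = 1 + s • B ∧ χ γ • ρ γ ≠ 1 := by
  by_contra! hχ
  obtain ⟨v, hv0, hv⟩ := h
  obtain ⟨t, ht, hτt⟩ := exists_isUnit_apply_oneAddMul hp hs hψ hτ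
  have hvE := congruenceEigenspace_le_of_isSocleGenerator hp hs <|
    mem_congruenceEigenspace_of_diagCharacter hp.mul_self hv hτt
  let g : SL(2, R) := ⟨!![1, 0; 1, 1], by simp⟩
  obtain ⟨x, hx⟩ := congrModScalar_conj_of_smul_eq_one (hp.mul_self_of_isSocleGenerator hs) hψ
    exists_coeMonoidHom_eq coeMonoidHom_injective hv0 hvE (fun γ B _ => hχ γ B) g
  have hg : coeMonoidHom g = !![1, 0; 1, 1] := rfl
  have hg' : coeMonoidHom g⁻¹ = !![1, -0; -1, 1] := Matrix.adjugate_fin_two_of 1 0 1 1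
  have hst : s * t = 0 := by simpa [hg, hg'] using congrFun₂ hx 1 0
  exact hs.1 (ht.mul_left_eq_zero.1 hst)

variable [FiniteDimensional ℂ V] [ρ.IsIrreducible]

theorem finrank_eq_index_diagSubgroup_of_hasWeight [IsLocalRing R] (hp : IsSelfAnnihilating p)
    (hs : IsSocleGenerator s) (h2 : ¬ p ∣ 2) (hψ : ψ.IsPrimitive)
    (hτ : IsPrimitiveUnitCharacter s τ) (h : HasWeight ρ (diagCharacter hp.mul_self τ)) :
    finrank ℂ V = (diagSubgroup p).index := by
  obtain ⟨v, hv0, hv⟩ := id h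
  obtain ⟨t, ht, hτt⟩ := exists_isUnit_apply_oneAddMul hp hs hψ hτ
  rw [← sub_zero t] at ht
  exact finrank_eq_index_diagSubgroup hp h2 hψ ht hv0
    (mem_congruenceEigenspace_of_diagCharacter hp.mul_self hv hτt) h

variable {k : Type*} [Field k] {f : R →+* k} [IsLocalHom f] {v : V} {A : Matrix (Fin 2) (Fin 2) R}

theorem finrank_eq_index_diagSubgroup_iff (hf : Function.Surjective f)
    (hp : IsSelfAnnihilating p) (hs : IsSocleGenerator s) (h2 : ¬ p ∣ 2) (hψ : ψ.IsPrimitive)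
    (hA : IsCyclicMatrix A) (hv0 : v ≠ 0)
    (hv : v ∈ congruenceEigenspace coeMonoidHom p ψ ρ A) :
    finrank ℂ V = (diagSubgroup p).index ↔ HasDistinctEigenvalues (A.map f) := by
  have : IsLocalRing R := RingHom.domain_isLocalRing f
  refine ⟨fun h => of_not_not fun hA' => ?_, fun hA' => ?_⟩
  · exact (finrank_lt_index_diagSubgroup hf hp hA hA' hv0 hv).ne h
  · obtain ⟨τ, hτ, hweight⟩ :=
      exists_hasWeight_of_hasDistinctEigenvalues hf hp hs hψ hv0 hv hA'
    exact finrank_eq_index_diagSubgroup_of_hasWeight hp hs h2 hψ hτ hweight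

theorem finrank_le_index_diagSubgroup (hf : Function.Surjective f)
    (hp : IsSelfAnnihilating p) (hs : IsSocleGenerator s) (h2 : ¬ p ∣ 2) (hψ : ψ.IsPrimitive)
    (hA : IsCyclicMatrix A) (hv0 : v ≠ 0)
    (hv : v ∈ congruenceEigenspace coeMonoidHom p ψ ρ A) :
    finrank ℂ V ≤ (diagSubgroup p).index := by
  by_cases hA' : HasDistinctEigenvalues (A.map f)
  · exact ((finrank_eq_index_diagSubgroup_iff hf hp hs h2 hψ hA hv0 hv).2 hA').le
  · exact (finrank_lt_index_diagSubgroup hf hp hA hA' hv0 hv).le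

end ComplexDimension

/-! ### Quotients of a discrete valuation ring -/

section Quo

open Ideal.Quotient (mk mk_surjective)

theorem toResidue_surjective {O : Type*} [CommRing O] [IsLocalRing O] {n : ℕ} (hn : 1 ≤ n) :
    Function.Surjective (toResidue O hn) :=
  Ideal.Quotient.factor_surjective _

theorem isLocalHom_toResidue {O : Type*} [CommRing O] [IsLocalRing O] {n : ℕ} (hn : 1 ≤ n) :
    IsLocalHom (toResidue O hn) where
  map_nonunit x hx := by
    obtain ⟨y, rfl⟩ := mk_surjective x
    exact (isUnit_of_map_unit (residue O) y hx).map _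

theorem isLocalRing_quo (O : Type*) [CommRing O] [IsLocalRing O] {n : ℕ} (hn : 1 ≤ n) :
    IsLocalRing (Quo O n) :=
  have := isLocalHom_toResidue (O := O) hn
  RingHom.domain_isLocalRing (toResidue O hn)

theorem toResidue_red {O : Type*} [CommRing O] [IsLocalRing O] {i n : ℕ} (h : 1 ≤ i) (hi : i ≤ n)
    (x : Quo O n) : toResidue O h (red O hi x) = toResidue O (h.trans hi) x := by
  obtain ⟨y, rfl⟩ := mk_surjective x
  rfl

variable {O : Type*} [CommRing O] [IsDomain O] [IsDiscreteValuationRing O] {π : O}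

theorem mk_eq_zero_iff_dvd (hπ : Irreducible π) {n : ℕ} {x : O} :
    mk (maximalIdeal O ^ n) x = 0 ↔ π ^ n ∣ x := by
  rw [Ideal.Quotient.eq_zero_iff_mem, hπ.maximalIdeal_eq, Ideal.span_singleton_pow,
    Ideal.mem_span_singleton]

theorem mk_pow_dvd_mk_iff (hπ : Irreducible π) {i n : ℕ} (hi : i ≤ n) {x : O} :
    mk (maximalIdeal O ^ n) (π ^ i) ∣ mk (maximalIdeal O ^ n) x ↔ π ^ i ∣ x := by
  refine ⟨?_, map_dvd _⟩
  rintro ⟨c, hc⟩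
  obtain ⟨y, rfl⟩ := mk_surjective c
  rw [← map_mul, ← sub_eq_zero, ← map_sub, mk_eq_zero_iff_dvd hπ] at hc
  exact (dvd_sub_left (dvd_mul_right _ y)).1 ((pow_dvd_pow π hi).trans hc)

theorem red_eq_zero_iff (hπ : Irreducible π) {i n : ℕ} (hi : i ≤ n) {x : Quo O n} :
    red O hi x = 0 ↔ mk (maximalIdeal O ^ n) (π ^ i) ∣ x := by
  obtain ⟨y, rfl⟩ := mk_surjective x
  rw [mk_pow_dvd_mk_iff hπ hi, ← mk_eq_zero_iff_dvd hπ]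
  rfl

theorem card_quo (O : Type*) [CommRing O] [IsDomain O] [IsDiscreteValuationRing O] (n : ℕ) :
    Nat.card (Quo O n) = residueCard O ^ n :=
  cardQuot_pow_of_prime (IsDiscreteValuationRing.not_a_field O)

instance finite_quo [Finite (ResidueField O)] (n : ℕ) : Finite (Quo O n) := by
  refine Nat.finite_of_card_ne_zero ?_
  rw [card_quo]
  exact pow_ne_zero _ Nat.card_pos.ne'

theorem isSelfAnnihilating_mk_pow (hπ : Irreducible π) (l : ℕ) :
    IsSelfAnnihilating (mk (maximalIdeal O ^ (2 * l)) (π ^ l)) := by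
  intro y
  obtain ⟨y, rfl⟩ := mk_surjective y
  rw [← map_mul, mk_eq_zero_iff_dvd hπ, mk_pow_dvd_mk_iff hπ (by omega), two_mul, pow_add,
    mul_dvd_mul_iff_left (pow_ne_zero _ hπ.ne_zero)]

theorem isSocleGenerator_mk_pow (hπ : Irreducible π) {n : ℕ} (hn : 1 ≤ n) :
    IsSocleGenerator (mk (maximalIdeal O ^ n) (π ^ (n - 1))) := by
  constructor
  · rw [Ne, mk_eq_zero_iff_dvd hπ, pow_dvd_pow_iff hπ.ne_zero hπ.not_isUnit]
    omega
  · intro t ht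
    obtain ⟨y, rfl⟩ := mk_surjective t
    rw [Ne, mk_eq_zero_iff_dvd hπ] at ht
    have hy : y ≠ 0 := fun h => ht (by rw [h]; exact dvd_zero _)
    obtain ⟨j, hj⟩ := IsDiscreteValuationRing.associated_pow_irreducible hy hπ
    have hjn : j < n := not_le.1 fun hnj => ht ((pow_dvd_pow π hnj).trans hj.symm.dvd)
    exact map_dvd _ (hj.dvd.trans (pow_dvd_pow π (by omega)))

theorem not_mk_pow_dvd_two (hπ : Irreducible π) {e i n : ℕ}
    (he : Ideal.span {(2 : O)} = maximalIdeal O ^ e) (hei : e < i) (hi : i ≤ n) :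
    ¬ mk (maximalIdeal O ^ n) (π ^ i) ∣ 2 := by
  rw [hπ.maximalIdeal_eq, Ideal.span_singleton_pow, Ideal.span_singleton_eq_span_singleton] at he
  rw [← map_ofNat (mk (maximalIdeal O ^ n)) 2, mk_pow_dvd_mk_iff hπ hi, he.dvd_iff_dvd_right,
    pow_dvd_pow_iff hπ.ne_zero hπ.not_isUnit]
  omega

theorem mem_congruenceSubgroup_iff (hπ : Irreducible π) {i n : ℕ} (hi : i ≤ n) {γ : SL O n} :
    γ ∈ congruenceSubgroup O hi ↔
      ∃ B, coeMonoidHom γ = 1 + mk (maximalIdeal O ^ n) (π ^ i) • B := by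
  have hred : γ ∈ congruenceSubgroup O hi ↔ ∀ a b, red O hi ((γ.1 - 1) a b) = 0 := by
    rw [congruenceSubgroup, MonoidHom.mem_ker, Matrix.SpecialLinearGroup.ext_iff]
    refine forall₂_congr fun a b => ?_
    rw [Matrix.sub_apply, map_sub, sub_eq_zero, Matrix.one_apply, apply_ite (red O hi), map_one,
      map_zero]
    rfl
  simp only [hred, red_eq_zero_iff hπ, Dvd.dvd]
  refine ⟨fun h => ?_, fun ⟨B, hB⟩ a b => ⟨B a b, ?_⟩⟩
  · choose B hB using h
    exact ⟨Matrix.of B, sub_eq_iff_eq_add'.1 (Matrix.ext hB)⟩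
  · exact congrFun₂ (sub_eq_iff_eq_add'.2 hB) a b

theorem mem_congruenceEigenspace_of_psiClass (hπ : Irreducible π) {l : ℕ}
    {ψ : AddChar (Quo O (2 * l)) ℂ} {A : Matrix (Fin 2) (Fin 2) (Quo O l)} {V : Type*}
    [AddCommGroup V] [Module ℂ V] {ρ : Representation ℂ (SL O (2 * l)) V} {v : V}
    (hv : ∀ k : congruenceSubgroup O (by omega : l ≤ 2 * l), ρ k v = psiClass ψ A k • v) :
    v ∈ congruenceEigenspace coeMonoidHom (mk (maximalIdeal O ^ (2 * l)) (π ^ l)) ψ ρ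
      (lift A) := by
  intro γ B _ hγ
  have hmem := (mem_congruenceSubgroup_iff hπ (by omega)).2 ⟨B, hγ⟩
  rw [map_pow] at hγ
  rw [hv ⟨γ, hmem⟩, psiClass_eq ψ π A (lift A) B (lift_map A) ⟨γ, hmem⟩ hγ, map_pow]

theorem map_toResidue_lift {l : ℕ} (hl : 1 ≤ l) (A : Matrix (Fin 2) (Fin 2) (Quo O l)) :
    (lift A).map (toResidue O (by omega : 1 ≤ 2 * l)) = A.map (toResidue O hl) := by
  conv_rhs => rw [← lift_map A, Matrix.map_map]
  exact Matrix.ext fun i j => (toResidue_red hl (by omega) (lift A i j)).symm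

end Quo

/-! ### Primitive representations -/

section Equivalence

open Module

theorem nonempty_equiv_iff_of_hasWeight {R V W : Type*} [CommRing R] [Finite R] [IsLocalRing R]
    [AddCommGroup V] [Module ℂ V] [FiniteDimensional ℂ V] [AddCommGroup W] [Module ℂ W]
    [FiniteDimensional ℂ W] {p s : R} {ψ : AddChar R ℂ} {ρ : Representation ℂ SL(2, R) V}
    {σ : Representation ℂ SL(2, R) W} [ρ.IsIrreducible] [σ.IsIrreducible] {τ τ' : Rˣ →* ℂˣ}
    (hp : IsSelfAnnihilating p) (hs : IsSocleGenerator s) (h2 : ¬ p ∣ 2) (hψ : ψ.IsPrimitive)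
    (hτ : IsPrimitiveUnitCharacter s τ) (hτ' : IsPrimitiveUnitCharacter s τ')
    (hρ : HasWeight ρ (diagCharacter hp.mul_self τ))
    (hσ : HasWeight σ (diagCharacter hp.mul_self τ')) :
    Nonempty (ρ.Equiv σ) ↔ τ' = τ ∨ τ' = τ⁻¹ := by
  have hdimρ := finrank_eq_index_diagSubgroup_of_hasWeight hp hs h2 hψ hτ hρ
  have hdimσ := finrank_eq_index_diagSubgroup_of_hasWeight hp hs h2 hψ hτ' hσ
  refine ⟨fun ⟨e⟩ => ?_, ?_⟩
  · exact eq_or_eq_inv_of_hasWeight_diagCharacter hp hs h2 hψ hτ hτ'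
      (hρ.map e.toIntertwiningMap e.toLinearEquiv.injective) hσ
  · rintro (rfl | rfl)
    · exact nonempty_equiv_of_hasWeight hρ hσ hdimρ hdimσ
    · exact nonempty_equiv_of_hasWeight (hρ.diagCharacter_inv hp.mul_self) hσ hdimρ hdimσ

end Equivalence

section Primitive

open Module
open Ideal.Quotient (mk mk_surjective)

variable {O : Type*} [CommRing O] [IsDomain O] [IsDiscreteValuationRing O]
  [Finite (ResidueField O)] {π : O} {l : ℕ}

theorem index_diagSubgroup_quo (hπ : Irreducible π) (hl : 1 ≤ l) :
    (diagSubgroup (mk (maximalIdeal O ^ (2 * l)) (π ^ l))).index =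
      (residueCard O + 1) * residueCard O ^ (2 * l - 1) := by
  have h2l : 1 ≤ 2 * l := by omega
  have := isLocalHom_toResidue (O := O) h2l
  have h := index_diagSubgroup_mul_card (toResidue_surjective h2l) (isSelfAnnihilating_mk_pow hπ l)
  rw [card_quo, ← pow_sub_one_mul (by omega) (residueCard O), ← mul_assoc] at h
  exact Nat.eq_of_mul_eq_mul_right Nat.card_pos h

variable {V : Type*} [AddCommGroup V] [Module ℂ V]
  {ψ : AddChar (Quo O (2 * l)) ℂ} {ρ : Representation ℂ (SL O (2 * l)) V}

theorem isPrimitive_of_hasWeight (hπ : Irreducible π) (hl : 1 ≤ l) (hψ : ψ.IsPrimitive)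
    {τ : (Quo O (2 * l))ˣ →* ℂˣ}
    (hτ : IsPrimitiveUnitCharacter (mk (maximalIdeal O ^ (2 * l)) (π ^ (2 * l - 1))) τ)
    (hρ : HasWeight ρ (diagCharacter (isSelfAnnihilating_mk_pow hπ l).mul_self τ)) :
    IsPrimitive ρ := by
  have h2l : 1 ≤ 2 * l := by omega
  have := isLocalRing_quo O h2l
  have hne (χ : SL O (2 * l) → ℂ) :
      ∃ γ ∈ congruenceSubgroup O (Nat.sub_le (2 * l) 1), χ γ • ρ γ ≠ 1 := by
    obtain ⟨γ, B, hγ, h⟩ := exists_smul_apply_ne_one_of_hasWeight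
      (isSelfAnnihilating_mk_pow hπ l) (isSocleGenerator_mk_pow hπ h2l) hψ hτ hρ χ
    exact ⟨γ, (mem_congruenceSubgroup_iff hπ _).2 ⟨B, hγ⟩, h⟩
  refine ⟨fun h => ?_, fun χ h => ?_⟩
  · obtain ⟨γ, hγ, hγ1⟩ := hne 1
    exact hγ1 (by rw [Pi.one_apply, one_smul, h γ hγ])
  · obtain ⟨γ, hγ, hγ1⟩ := hne χ
    exact hγ1 (h γ hγ)

variable [FiniteDimensional ℂ V]

theorem exists_isCyclicMatrix_of_isPrimitive [ρ.IsIrreducible] (hπ : Irreducible π)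
    (hl : 1 ≤ l) (hψ : ψ.IsPrimitive) (hρ : IsPrimitive ρ) :
    ∃ A, IsCyclicMatrix A ∧
      ∃ v ≠ 0, v ∈ congruenceEigenspace coeMonoidHom (mk (maximalIdeal O ^ (2 * l)) (π ^ l))
        ψ ρ A := by
  have h2l : 1 ≤ 2 * l := by omega
  have := isLocalRing_quo O h2l
  have : Nontrivial V := nontrivial_of_isIrreducible ρ
  have hp := isSelfAnnihilating_mk_pow hπ l
  obtain ⟨A, v, hv0, hv⟩ := exists_mem_congruenceEigenspace hψ hp ρ
  obtain ⟨γ, hγ, hργ⟩ := not_forall₂.1 hρ.1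
  obtain ⟨B, hB⟩ := (mem_congruenceSubgroup_iff hπ (Nat.sub_le _ 1)).1 hγ
  exact ⟨A, isCyclicMatrix_of_apply_ne_one hp (isSocleGenerator_mk_pow hπ h2l) hv0 hv hB hργ,
    v, hv0, hv⟩

variable {e : ℕ}

theorem finrank_le_of_isPrimitive [ρ.IsIrreducible] (hπ : Irreducible π)
    (he : Ideal.span {(2 : O)} = maximalIdeal O ^ e) (hl : e < l) (hψ : ψ.IsPrimitive)
    (hρ : IsPrimitive ρ) :
    finrank ℂ V ≤ (residueCard O + 1) * residueCard O ^ (2 * l - 1) := by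
  have h2l : 1 ≤ 2 * l := by omega
  have := isLocalHom_toResidue (O := O) h2l
  obtain ⟨A, hA, v, hv0, hv⟩ := exists_isCyclicMatrix_of_isPrimitive hπ (by omega) hψ hρ
  rw [← index_diagSubgroup_quo hπ (by omega)]
  exact finrank_le_index_diagSubgroup (toResidue_surjective h2l) (isSelfAnnihilating_mk_pow hπ l)
    (isSocleGenerator_mk_pow hπ h2l) (not_mk_pow_dvd_two hπ he hl (by omega)) hψ hA hv0 hv

theorem finrank_eq_iff_isSplitSemisimple (hπ : Irreducible π)
    (he : Ideal.span {(2 : O)} = maximalIdeal O ^ e) (hl : e < l) (hψ : ψ.IsPrimitive)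
    {A : Matrix (Fin 2) (Fin 2) (Quo O l)} (hA : IsCyclicMatrix A)
    (hρ : IsIrrAbove ρ (psiClass ψ A)) :
    finrank ℂ V = (residueCard O + 1) * residueCard O ^ (2 * l - 1) ↔
      IsSplitSemisimple (A.map (toResidue O (Nat.one_le_of_lt hl))) := by
  have h2l : 1 ≤ 2 * l := by omega
  have := isLocalRing_quo O h2l
  have := isLocalHom_toResidue (O := O) h2l
  have := hρ.1
  obtain ⟨v, hv0, hv⟩ := hρ.hasWeight
  have hAres := hA.map (toResidue O (Nat.one_le_of_lt hl))
  rw [← index_diagSubgroup_quo hπ (by omega), hAres.isSplitSemisimple_iff]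
  rw [← map_toResidue_lift (Nat.one_le_of_lt hl)] at hAres ⊢
  exact finrank_eq_index_diagSubgroup_iff (toResidue_surjective h2l)
    (isSelfAnnihilating_mk_pow hπ l) (isSocleGenerator_mk_pow hπ h2l)
    (not_mk_pow_dvd_two hπ he hl (by omega)) hψ hAres.of_map hv0
    (mem_congruenceEigenspace_of_psiClass hπ hv)

theorem exists_isPrimitive_hasWeight (hπ : Irreducible π)
    (he : Ideal.span {(2 : O)} = maximalIdeal O ^ e) (hl : e < l) (hψ : ψ.IsPrimitive)
    {τ : (Quo O (2 * l))ˣ →* ℂˣ}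
    (hτ : IsPrimitiveUnitCharacter (mk (maximalIdeal O ^ (2 * l)) (π ^ (2 * l - 1))) τ) :
    ∃ σ : Representation ℂ (SL O (2 * l))
        (Fin ((residueCard O + 1) * residueCard O ^ (2 * l - 1)) → ℂ),
      (σ.IsIrreducible ∧ IsPrimitive σ) ∧
        HasWeight σ (diagCharacter (isSelfAnnihilating_mk_pow hπ l).mul_self τ) := by
  have h2l : 1 ≤ 2 * l := by omega
  have := isLocalRing_quo O h2l
  have hp := isSelfAnnihilating_mk_pow hπ l
  obtain ⟨d, σ, hσ, hweight⟩ := exists_isIrreducible_hasWeight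
    (diagSubgroup (mk (maximalIdeal O ^ (2 * l)) (π ^ l))) (diagCharacter hp.mul_self τ)
  have hd := finrank_eq_index_diagSubgroup_of_hasWeight hp (isSocleGenerator_mk_pow hπ h2l)
    (not_mk_pow_dvd_two hπ he hl (by omega)) hψ hτ hweight
  rw [finrank_fin_fun, index_diagSubgroup_quo hπ (by omega)] at hd
  subst hd
  exact ⟨σ, ⟨hσ, isPrimitive_of_hasWeight hπ (by omega) hψ hτ hweight⟩, hweight⟩

theorem exists_hasWeight_of_isPrimitive [ρ.IsIrreducible] (hπ : Irreducible π)
    (he : Ideal.span {(2 : O)} = maximalIdeal O ^ e) (hl : e < l) (hψ : ψ.IsPrimitive)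
    (hρ : IsPrimitive ρ)
    (hdim : finrank ℂ V = (residueCard O + 1) * residueCard O ^ (2 * l - 1)) :
    ∃ τ, IsPrimitiveUnitCharacter (mk (maximalIdeal O ^ (2 * l)) (π ^ (2 * l - 1))) τ ∧
      HasWeight ρ (diagCharacter (isSelfAnnihilating_mk_pow hπ l).mul_self τ) := by
  have h2l : 1 ≤ 2 * l := by omega
  have := isLocalHom_toResidue (O := O) h2l
  have hp := isSelfAnnihilating_mk_pow hπ l
  have hs := isSocleGenerator_mk_pow hπ h2l
  have hf := toResidue_surjective (O := O) h2l
  obtain ⟨A, hA, v, hv0, hv⟩ := exists_isCyclicMatrix_of_isPrimitive hπ (by omega) hψ hρ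
  rw [← index_diagSubgroup_quo hπ (by omega), finrank_eq_index_diagSubgroup_iff hf hp hs
    (not_mk_pow_dvd_two hπ he hl (by omega)) hψ hA hv0 hv] at hdim
  exact exists_hasWeight_of_hasDistinctEigenvalues hf hp hs hψ hv0 hv hdim

theorem card_isPrimitiveUnitCharacter_quo (hπ : Irreducible π) (hl : 1 ≤ l) :
    Nat.card {τ : (Quo O (2 * l))ˣ →* ℂˣ //
        IsPrimitiveUnitCharacter (mk (maximalIdeal O ^ (2 * l)) (π ^ (2 * l - 1))) τ} =
      (residueCard O - 1) ^ 2 * residueCard O ^ (2 * l - 2) := by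
  have h2l : 1 ≤ 2 * l := by omega
  have := isLocalHom_toResidue (O := O) h2l
  have hs : ¬ IsUnit (mk (maximalIdeal O ^ (2 * l)) (π ^ (2 * l - 1))) := fun h => by
    rw [map_pow, isUnit_pow_iff (by omega)] at h
    exact hπ.not_isUnit (isUnit_of_map_unit (residue O) π (h.map (toResidue O h2l)))
  have h := card_isPrimitiveUnitCharacter_mul (M := ℂ) (toResidue_surjective h2l)
    (isSocleGenerator_mk_pow hπ h2l) hs
  rw [card_quo, ← pow_sub_mul_pow (residueCard O) (by omega : 2 ≤ 2 * l), ← mul_assoc] at h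
  exact Nat.eq_of_mul_eq_mul_right (pow_pos Nat.card_pos 2) h

theorem two_mul_numPrimitive (hπ : Irreducible π)
    (he : Ideal.span {(2 : O)} = maximalIdeal O ^ e) (hl : e < l) (hψ : ψ.IsPrimitive) :
    2 * numPrimitive O (2 * l) ((residueCard O + 1) * residueCard O ^ (2 * l - 1)) =
      (residueCard O - 1) ^ 2 * residueCard O ^ (2 * l - 2) := by
  have h2l : 1 ≤ 2 * l := by omega
  have := isLocalRing_quo O h2l
  have hp := isSelfAnnihilating_mk_pow hπ l
  have hs := isSocleGenerator_mk_pow hπ h2l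
  have h2 := not_mk_pow_dvd_two hπ he hl (by omega : l ≤ 2 * l)
  rw [← card_isPrimitiveUnitCharacter_quo hπ (by omega), numPrimitive]
  choose σ hσ hweight using fun τ : {τ : (Quo O (2 * l))ˣ →* ℂˣ // IsPrimitiveUnitCharacter
    (mk (maximalIdeal O ^ (2 * l)) (π ^ (2 * l - 1))) τ} =>
      exists_isPrimitive_hasWeight hπ he hl hψ τ.2
  have hirr (τ : _) : (σ τ).IsIrreducible := (hσ τ).1
  refine (card_eq_two_mul_of_fibers (F := fun τ => Quotient.mk (primitiveSetoid O (2 * l) _)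
    ⟨σ τ, hσ τ⟩) ?_ (i := fun τ => ⟨τ.1⁻¹, τ.2.imp fun u hu => ⟨hu.1, inv_ne_one.2 hu.2⟩⟩)
    ?_ fun τ τ' => ?_).symm
  · refine Quotient.ind fun ⟨ρ, hρ, hprim⟩ => ?_
    obtain ⟨τ, hτ, hρτ⟩ :=
      exists_hasWeight_of_isPrimitive hπ he hl hψ hprim (finrank_fin_fun ℂ)
    exact ⟨⟨τ, hτ⟩, Quotient.sound <|
      (nonempty_equiv_iff_of_hasWeight hp hs h2 hψ hτ hτ (hweight ⟨τ, hτ⟩) hρτ).2 (Or.inl rfl)⟩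
  · exact fun τ h => ne_inv_of_isPrimitiveUnitCharacter hp hs h2 hψ τ.2 (congrArg Subtype.val h)
  · rw [Quotient.eq, Subtype.ext_iff, Subtype.ext_iff]
    exact nonempty_equiv_iff_of_hasWeight hp hs h2 hψ τ.2 τ'.2 (hweight τ) (hweight τ')

end Primitive

end SLTwo

end

theorem mainTheorem10_general {O : Type*} [CommRing O] [IsDomain O] [IsDiscreteValuationRing O]
    [Finite (IsLocalRing.ResidueField O)]
    (π : O) (hπ : Irreducible π)
    (e : ℕ) (he : Ideal.span {(2 : O)} = IsLocalRing.maximalIdeal O ^ e)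
    (l : ℕ) (hl : e < l)
    (ψ : AddChar (SLTwo.Quo O (2 * l)) ℂ)
    (hψ : ψ (Ideal.Quotient.mk (IsLocalRing.maximalIdeal O ^ (2 * l)) (π ^ (2 * l - 1))) ≠ 1) :
    (∀ {V : Type*} [AddCommGroup V] [Module ℂ V] [FiniteDimensional ℂ V]
        (ρ : Representation ℂ (SLTwo.SL O (2 * l)) V),
        ρ.IsIrreducible → SLTwo.IsPrimitive ρ →
          Module.finrank ℂ V ≤ (SLTwo.residueCard O + 1) * SLTwo.residueCard O ^ (2 * l - 1)) ∧
    (∀ A : Matrix (Fin 2) (Fin 2) (SLTwo.Quo O l), SLTwo.IsCyclicMatrix A →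
      ∀ {V : Type*} [AddCommGroup V] [Module ℂ V] [FiniteDimensional ℂ V]
        (ρ : Representation ℂ (SLTwo.SL O (2 * l)) V),
        SLTwo.IsIrrAbove ρ (SLTwo.psiClass ψ A) →
          (Module.finrank ℂ V = (SLTwo.residueCard O + 1) * SLTwo.residueCard O ^ (2 * l - 1) ↔
            SLTwo.IsSplitSemisimple
              (A.map (SLTwo.toResidue O (Nat.one_le_of_lt hl))))) ∧
    (SLTwo.numPrimitive O (2 * l)
        ((SLTwo.residueCard O + 1) * SLTwo.residueCard O ^ (2 * l - 1)) : ℚ) =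
      ((SLTwo.residueCard O : ℚ) - 1) ^ 2 * (SLTwo.residueCard O : ℚ) ^ (2 * l - 2) / 2 := by
  have hψ' := (SLTwo.isSocleGenerator_mk_pow hπ (by omega : 1 ≤ 2 * l)).isPrimitive hψ
  refine ⟨?_, ?_, ?_⟩
  · intro V _ _ _ ρ hρ hprim
    exact SLTwo.finrank_le_of_isPrimitive hπ he hl hψ' hprim
  · intro A hA V _ _ _ ρ hρ
    exact SLTwo.finrank_eq_iff_isSplitSemisimple hπ he hl hψ' hA hρ
  · have hcount := congrArg (Nat.cast (R := ℚ)) (SLTwo.two_mul_numPrimitive hπ he hl hψ')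
    have hq : 1 ≤ SLTwo.residueCard O := Nat.card_pos
    push_cast [Nat.cast_sub hq] at hcount
    rw [← hcount]
    ring

theorem mainTheorem10 {O : Type*} [CommRing O] [IsDomain O] [IsDiscreteValuationRing O]
    [IsAdicComplete (IsLocalRing.maximalIdeal O) O] [Finite (IsLocalRing.ResidueField O)]
    [CharP (IsLocalRing.ResidueField O) 2] [CharZero O]
    (π : O) (hπ : Irreducible π)
    (e : ℕ) (he : Ideal.span {(2 : O)} = IsLocalRing.maximalIdeal O ^ e)
    (l : ℕ) (hl : e < l)
    (ψ : AddChar (SLTwo.Quo O (2 * l)) ℂ)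
    (hψ : ψ (Ideal.Quotient.mk (IsLocalRing.maximalIdeal O ^ (2 * l)) (π ^ (2 * l - 1))) ≠ 1) :
    (∀ {V : Type*} [AddCommGroup V] [Module ℂ V] [FiniteDimensional ℂ V]
        (ρ : Representation ℂ (SLTwo.SL O (2 * l)) V),
        ρ.IsIrreducible → SLTwo.IsPrimitive ρ →
          Module.finrank ℂ V ≤ (SLTwo.residueCard O + 1) * SLTwo.residueCard O ^ (2 * l - 1)) ∧
    (∀ A : Matrix (Fin 2) (Fin 2) (SLTwo.Quo O l), SLTwo.IsCyclicMatrix A →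
      ∀ {V : Type*} [AddCommGroup V] [Module ℂ V] [FiniteDimensional ℂ V]
        (ρ : Representation ℂ (SLTwo.SL O (2 * l)) V),
        SLTwo.IsIrrAbove ρ (SLTwo.psiClass ψ A) →
          (Module.finrank ℂ V = (SLTwo.residueCard O + 1) * SLTwo.residueCard O ^ (2 * l - 1) ↔
            SLTwo.IsSplitSemisimple
              (A.map (SLTwo.toResidue O (Nat.one_le_of_lt hl))))) ∧
    (SLTwo.numPrimitive O (2 * l)
        ((SLTwo.residueCard O + 1) * SLTwo.residueCard O ^ (2 * l - 1)) : ℚ) =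
      ((SLTwo.residueCard O : ℚ) - 1) ^ 2 * (SLTwo.residueCard O : ℚ) ^ (2 * l - 2) / 2 :=
  mainTheorem10_general π hπ e he l hl ψ hψ
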